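/- Let $M$ be a compact connected oriented smooth $3$-manifold with non-empty boundary, let $\hat M$ be the space obtained from $M$ by collapsing each boundary component to one point, and let $V\subset\hat M$ be the set of these points. An ideal triangulation $T$ of $\hat M$ is a realization of $\hat M$ by finitely many abstract tetrahedra with all their $2$-faces glued in pairs (self and multiple adjacencies are allowed) whose set of vertices is $V$. A branching $b$ on $T$ is a system of orientations of the edges of $T$ which on every abstract tetrahedron is induced by a total ordering of its vertices, each edge going towards its bigger endpoint. A pre-branching $\omega$ on $T$ is a system of transverse orientations of the $2$-faces of $T$, equivalently of orientations of their dual edges, such that at every tetrahedron two dual edges are ingoing and two are outgoing. A branching $b$ induces a pre-branching $\omega_b$: orient the $2$-cell dual to each $b$-oriented edge so that its intersection number with that edge is $1$; at every dual edge the three incident oriented $2$-cells do not all induce the same boundary orientation, and $\omega_b$ is the prevailing one, induced by two of them. The positive ideal moves $T\to T'$ are the $2\to 3$ move (two distinct abstract tetrahedra with a common face are replaced by three tetrahedra around a new edge) and the quadrilateral $0\to 2$ move (a quadrilateral formed by two distinct triangles with a common edge is opened and replaced by a pillow made of two tetrahedra, glued to each other along a copy of the quadrilateral with the other diagonal). A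 positive $b$-transit $(T,b)\to(T',b')$ (resp. $pb$-transit $(T,\omega)\to(T',\omega')$) is such a move for which the edge orientations (resp. the transverse face orientations) agree on all edges (resp. $2$-faces) that persist; for the $0\to 2$ move the two copies of the quadrilateral bounding the pillow both carry the orientations of the initial one. Negative transits are the inverses of the positive ones. Let $\mathcal B^{id}(M)$ (resp. $\mathcal{PB}^{id}(M)$) be the set of branched (resp. pre-branched) ideal triangulations of $\hat M$ up to the equivalence relation generated by isotopies of $\hat M$ that keep $V$ pointwise fixed and by positive and negative $b$-transits (resp. $pb$-transits). Since every $b$-transit $(T,b)\to(T',b')$ induces a $pb$-transit $(T,\omega_b)\to(T',\omega_{b'})$, there is a well-defined forgetting map $\phi:\mathcal B^{id}(M)\to\mathcal{PB}^{id}(M)$, $\phi([(T,b)])=[(T,\omega_b)]$. Then, for every pre-branched ideal triangulation $(T,\omega)$ of $\hat M$, the class $[(T,\omega)]$ belongs to the image of $\phi$ if and only if there exists a branching $b$ on the same triangulation $T$ such that $[(T,\omega)]=[(T,\omega_b)]$ in $\mathcal{PB}^{id}(M)$. -/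

import Mathlib

open scoped Manifold ContDiff

namespace IdealTri

/-! ## The pseudomanifold of a compact 3-manifold with boundary -/

section Pseudomanifold

variable (M : Type*) [TopologicalSpace M] [ChartedSpace (EuclideanHalfSpace 3) M]

/-- Two points are identified when they are equal or lie in the same boundary component. -/
def collapseSetoid : Setoid M where
  r x y := x = y ∨ (x ∈ (𝓡∂ 3).boundary M ∧ y ∈ (𝓡∂ 3).boundary M ∧
    connectedComponentIn ((𝓡∂ 3).boundary M) x = connectedComponentIn ((𝓡∂ 3).boundary M) y)
  iseqv :=
    { refl := fun _ => Or.inl rfl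
      symm := by
        rintro x y (h | ⟨h1, h2, h3⟩)
        · exact Or.inl h.symm
        · exact Or.inr ⟨h2, h1, h3.symm⟩
      trans := by
        rintro x y z (rfl | ⟨h1, h2, h3⟩) (rfl | ⟨k1, k2, k3⟩)
        · exact Or.inl rfl
        · exact Or.inr ⟨k1, k2, k3⟩
        · exact Or.inr ⟨h1, h2, h3⟩
        · exact Or.inr ⟨h1, k2, h3.trans k3⟩ }

/-- The space obtained from `M` by collapsing each boundary component to one point. -/
def Hat : Type _ := Quotient (collapseSetoid M)

instance : TopologicalSpace (Hat M) :=
  inferInstanceAs (TopologicalSpace (Quotient (collapseSetoid M)))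

/-- The quotient map from `M` to its collapsed space. -/
def toHat (x : M) : Hat M := Quotient.mk (collapseSetoid M) x

/-- The set `V` of the points that come from the boundary components. -/
def marked : Set (Hat M) := toHat M '' (𝓡∂ 3).boundary M

/-- The interior of `M`, as a space. -/
abbrev Int : Type _ := {x : M // x ∈ (𝓡∂ 3).interior M}

end Pseudomanifold

/-! ## Orientations -/

/-- The standard 3-simplex, in barycentric coordinates. -/
abbrev Tet : Type := stdSimplex ℝ (Fin 4)

/-- The open standard 3-simplex. -/
abbrev OpenTet : Type := {x : Tet // ∀ v, 0 < x.1 v}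

/-- Embedded open tetrahedra with ordered vertices. -/
abbrev EmbTet (X : Type*) [TopologicalSpace X] : Type _ :=
  {e : OpenTet → X // Topology.IsOpenEmbedding e}

/-- An orientation of a 3-manifold `X`: every embedded open tetrahedron with ordered vertices is
either positive or negative, the sign does not change under isotopy of embeddings, and it is
multiplied by the sign of the permutation when the vertices are reordered. -/
structure Orientation3 (X : Type*) [TopologicalSpace X] where
  sgn : EmbTet X → ℤˣ
  isotopy : ∀ F : unitInterval → EmbTet X,
    Continuous (fun p : unitInterval × OpenTet => (F p.1).1 p.2) → sgn (F 0) = sgn (F 1)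
  reorder : ∀ (π : Equiv.Perm (Fin 4)) (e e' : EmbTet X),
    (∀ x y : OpenTet, (∀ v, y.1.1 (π v) = x.1.1 v) → e'.1 y = e.1 x) →
      sgn e' = Equiv.Perm.sign π * sgn e

/-! ## Oriented gluings of tetrahedra -/

/-- A finite family of abstract oriented tetrahedra, with vertices labelled by `Fin 4`, whose faces
are glued in pairs. Face `f` of a tetrahedron is the one opposite to vertex `f`. Face `f` of `i` is
glued to a face of `adj i f`: the permutation `perm i f` sends each vertex of the face to the
vertex it is glued to, and `f` to the vertex opposite to the target face. The tetrahedron `i`, with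
the vertex ordering `0,1,2,3`, has sign `sgn i`, and the gluings reverse the orientation. -/
structure Gluing where
  n : ℕ
  adj : Fin n → Fin 4 → Fin n
  perm : Fin n → Fin 4 → Equiv.Perm (Fin 4)
  adj_adj : ∀ i f, adj (adj i f) (perm i f f) = i
  perm_perm : ∀ i f, perm (adj i f) (perm i f f) = (perm i f)⁻¹
  ne_self : ∀ i f, ¬ (adj i f = i ∧ perm i f f = f)
  sgn : Fin n → ℤˣ
  sgn_adj : ∀ i f, sgn (adj i f) = - (Equiv.Perm.sign (perm i f) * sgn i)

namespace Gluing

/-- A flag `(i, σ)` is the tetrahedron `i` with its vertices ordered as `σ 0, σ 1, σ 2, σ 3`; it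
stands for the face of `i` opposite to `σ 3` with its vertices ordered as `σ 0, σ 1, σ 2`. -/
abbrev Flag (K : Gluing) : Type := Fin K.n × Equiv.Perm (Fin 4)

/-- The same ordered face, seen from the tetrahedron on its other side. -/
def opp (K : Gluing) (F : K.Flag) : K.Flag :=
  (K.adj F.1 (F.2 3), K.perm F.1 (F.2 3) * F.2)

/-- The abstract face (tetrahedron and opposite vertex) underlying a flag. -/
def face (K : Gluing) (F : K.Flag) : Fin K.n × Fin 4 := (F.1, F.2 3)

/-- Same tetrahedron and same edge `σ 0, σ 1`, but the other face of the tetrahedron at that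
edge. -/
def turn (K : Gluing) (F : K.Flag) : K.Flag := (F.1, F.2 * Equiv.swap 2 3)

/-- The point `p` of a face is glued to the point `q` of the adjacent face. -/
def GlueRel (K : Gluing) (p q : Fin K.n × Tet) : Prop :=
  ∃ f, p.2.1 f = 0 ∧ q.1 = K.adj p.1 f ∧ ∀ v, q.2.1 (K.perm p.1 f v) = p.2.1 v

/-- The space obtained by gluing the tetrahedra. -/
def Space (K : Gluing) : Type := Quot K.GlueRel

instance (K : Gluing) : TopologicalSpace K.Space :=
  inferInstanceAs (TopologicalSpace (Quot K.GlueRel))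

/-- The point of the glued space with barycentric coordinates `x` in the tetrahedron `i`. -/
def pt (K : Gluing) (i : Fin K.n) (x : Tet) : K.Space := Quot.mk K.GlueRel (i, x)

end Gluing

/-! ## Ideal triangulations -/

section Triangulation

variable {M : Type*} [TopologicalSpace M] [ChartedSpace (EuclideanHalfSpace 3) M]

/-- An ideal triangulation of the collapsed space of the oriented manifold `M`: a gluing, and a
homeomorphism of the glued space onto the collapsed space that sends exactly the vertices to the
marked points and respects the orientations. -/
structure IdealTriangulation (o : Orientation3 (Int M)) where
  K : Gluing
  h : K.Space ≃ₜ Hat M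
  vertices : ∀ i x, h (K.pt i x) ∈ marked M ↔ ∃ v, x.1 v = 1
  oriented : ∀ i, ∃ e : EmbTet (Int M),
    (∀ x : OpenTet, toHat M (e.1 x).1 = h (K.pt i x.1)) ∧ o.sgn e = K.sgn i

end Triangulation

/-! ## Branchings and pre-branchings -/

/-- A branching: in each tetrahedron the vertices are totally ordered (`ord i v` is the position of
the vertex `v`), and the orientations of the edges from the smaller to the bigger endpoint match
under the gluings, so that they are orientations of the edges of the triangulation. -/
structure Branching (K : Gluing) where
  ord : Fin K.n → Equiv.Perm (Fin 4)
  glue : ∀ i f u v, u ≠ f → v ≠ f →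
    (ord i u < ord i v ↔
      ord (K.adj i f) (K.perm i f u) < ord (K.adj i f) (K.perm i f v))

/-- A pre-branching: every face has a transverse orientation, equivalently its dual edge is
oriented, and at every tetrahedron two dual edges are ingoing and two are outgoing. Here
`dir i f = 1` means that the dual edge of the face `f` goes into `i`, and `dir i f = -1` that it
goes out of `i`. -/
structure PreBranching (K : Gluing) where
  dir : Fin K.n → Fin 4 → ℤ
  unit : ∀ i f, dir i f = 1 ∨ dir i f = -1
  glue : ∀ i f, dir (K.adj i f) (K.perm i f f) = - dir i f
  ingoing : ∀ i, (Finset.univ.filter (fun f => dir i f = 1)).card = 2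
  outgoing : ∀ i, (Finset.univ.filter (fun f => dir i f = -1)).card = 2

/-- For a tetrahedron with vertex ordering `r`, positively oriented by its labels, the sum over the
three edges of the face `f`, oriented as `σ 0 → σ 1`, of the orientation (`1` if ingoing) that the
dual region of the edge, oriented so as to have intersection number `1` with the edge, induces on
the dual edge of `f` by the boundary orientation. -/
def bdry (r : Equiv.Perm (Fin 4)) (f : Fin 4) : ℤ :=
  ∑ σ : Equiv.Perm (Fin 4) with σ 3 = f ∧ r (σ 0) < r (σ 1), (Equiv.Perm.sign σ : ℤ)

theorem bdry_transport (r r' π : Equiv.Perm (Fin 4)) (f : Fin 4)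
    (H : ∀ u v, u ≠ f → v ≠ f → (r u < r v ↔ r' (π u) < r' (π v))) :
    bdry r' (π f) = Equiv.Perm.sign π * bdry r f := by
  unfold bdry
  rw [Finset.mul_sum]
  symm
  refine Finset.sum_equiv (Equiv.mulLeft π) ?_ ?_
  · intro σ
    simp only [Finset.mem_filter, Finset.mem_univ, true_and, Equiv.coe_mulLeft,
      Equiv.Perm.mul_apply, EmbeddingLike.apply_eq_iff_eq]
    refine and_congr_right fun h3 => H _ _ ?_ ?_
    · rw [← h3]; exact fun h => absurd (σ.injective h) (by decide)
    · rw [← h3]; exact fun h => absurd (σ.injective h) (by decide)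
  · intro σ _
    simp

theorem bdry_one : ∀ f, bdry 1 f = ![-1, 1, -1, 1] f := by decide +kernel

theorem bdry_eq (r : Equiv.Perm (Fin 4)) (f : Fin 4) :
    bdry r f = Equiv.Perm.sign r * ![-1, 1, -1, 1] (r f) := by
  have h := bdry_transport r 1 r f (fun u v _ _ => by simp)
  rw [bdry_one] at h
  rw [h, ← mul_assoc, ← Units.val_mul, Int.units_mul_self]
  simp

/-- The pre-branching induced by a branching: each dual edge gets the sum of the orientations that
are induced by the three incident regions, that is, the prevailing one. -/
def Branching.toPre {K : Gluing} (b : Branching K) : PreBranching K where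
  dir i f := K.sgn i * bdry (b.ord i) f
  unit i f := by
    rw [bdry_eq]
    generalize b.ord i f = w
    rcases Int.units_eq_one_or (K.sgn i) with h | h <;>
    rcases Int.units_eq_one_or (Equiv.Perm.sign (b.ord i)) with h' | h' <;>
    rw [h, h'] <;> revert w <;> decide
  glue i f := by
    have h := bdry_transport (b.ord i) (b.ord (K.adj i f)) (K.perm i f) f (b.glue i f)
    rw [h, K.sgn_adj]
    have h2 : ((Equiv.Perm.sign (K.perm i f) : ℤˣ) : ℤ) * (Equiv.Perm.sign (K.perm i f) : ℤˣ) = 1 := by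
      rw [← Units.val_mul, Int.units_mul_self]; rfl
    push_cast
    linear_combination (-(K.sgn i : ℤ) * bdry (b.ord i) f) * h2
  ingoing i := by
    have h : ∀ s t : ℤˣ, (Finset.univ.filter
        (fun w : Fin 4 => (s : ℤ) * ((t : ℤ) * ![-1, 1, -1, 1] w) = 1)).card = 2 := by decide
    rw [← h (K.sgn i) (Equiv.Perm.sign (b.ord i))]
    refine Finset.card_equiv (b.ord i) fun f => ?_
    simp only [Finset.mem_filter, Finset.mem_univ, true_and, bdry_eq]
  outgoing i := by
    have h : ∀ s t : ℤˣ, (Finset.univ.filter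
        (fun w : Fin 4 => (s : ℤ) * ((t : ℤ) * ![-1, 1, -1, 1] w) = -1)).card = 2 := by decide
    rw [← h (K.sgn i) (Equiv.Perm.sign (b.ord i))]
    refine Finset.card_equiv (b.ord i) fun f => ?_
    simp only [Finset.mem_filter, Finset.mem_univ, true_and, bdry_eq]

/-! ## Naked combinatorial moves

Each move comes with a correspondence between flags, which says which ordered faces of the first
triangulation persist in the second one. -/

/-- An isomorphism of oriented gluings: the same triangulation with other names for the tetrahedra
and their vertices. -/
structure Relabelling (K K' : Gluing) where
  e : Fin K.n ≃ Fin K'.n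
  s : Fin K.n → Equiv.Perm (Fin 4)
  glue : ∀ F : K.Flag, K'.opp (e F.1, s F.1 * F.2) = (e (K.opp F).1, s (K.opp F).1 * (K.opp F).2)
  sgn : ∀ i, K'.sgn (e i) = Equiv.Perm.sign (s i) * K.sgn i

def Relabelling.corr {K K' : Gluing} (m : Relabelling K K') (F : K.Flag) (F' : K'.Flag) : Prop :=
  F' = (m.e F.1, m.s F.1 * F.2)

/-- The names of the vertices of the bipyramid: two apices and three equatorial vertices. -/
abbrev BiVertex : Type := Fin 2 ⊕ Fin 3

/-- The vertices of the tetrahedron with apex `a` over the equatorial triangle. -/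
def twoName (a : Fin 2) : Fin 4 → BiVertex := ![.inl a, .inr 0, .inr 1, .inr 2]

/-- The vertices of the tetrahedron that has both apices and is opposite to the equatorial
vertex `k`. -/
def threeName (k : Fin 3) : Fin 4 → BiVertex := ![.inl 0, .inl 1, .inr (k + 1), .inr (k + 2)]

/-- The vertices of a convex bipyramid in `ℝ³`. -/
noncomputable def biPos : BiVertex → (Fin 3 → ℝ)
  | .inl 0 => fun _ => 0
  | .inl 1 => fun _ => 2 / 3
  | .inr k => Pi.single k 1

/-- The persistent ordered faces of a `2 → 3` move: those of the tetrahedra that are not involved,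
and the six faces of the bipyramid. -/
def biCorr {n n' : ℕ} (two : Fin 2 → Fin n) (three : Fin 3 → Fin n')
    (e : {i // ∀ a, i ≠ two a} ≃ {j // ∀ k, j ≠ three k})
    (F : Fin n × Equiv.Perm (Fin 4)) (F' : Fin n' × Equiv.Perm (Fin 4)) : Prop :=
  (∃ hi : ∀ a, F.1 ≠ two a, F' = ((e ⟨F.1, hi⟩ : Fin n'), F.2)) ∨
  (∃ a k, F.1 = two a ∧ F'.1 = three k ∧
    ∀ p, p ≠ 3 → twoName a (F.2 p) = threeName k (F'.2 p))

/-- A positive `2 → 3` move: two distinct tetrahedra with a common face are replaced by three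
tetrahedra around a new edge. -/
structure TwoThree (K K' : Gluing) where
  two : Fin 2 → Fin K.n
  three : Fin 3 → Fin K'.n
  two_inj : Function.Injective two
  three_inj : Function.Injective three
  e : {i // ∀ a, i ≠ two a} ≃ {j // ∀ k, j ≠ three k}
  glue_two : ∀ a a' σ σ', a ≠ a' →
    (∀ p, p ≠ 3 → twoName a (σ p) = twoName a' (σ' p)) → K.opp (two a, σ) = (two a', σ')
  glue_three : ∀ k k' σ σ', k ≠ k' →
    (∀ p, p ≠ 3 → threeName k (σ p) = threeName k' (σ' p)) → K'.opp (three k, σ) = (three k', σ')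
  glue : ∀ F F', biCorr two three e F F' → biCorr two three e (K.opp F) (K'.opp F')
  sgn : ∀ F F', biCorr two three e F F' →
    K.sgn F.1 * Equiv.Perm.sign F.2 = K'.sgn F'.1 * Equiv.Perm.sign F'.2

def TwoThree.corr {K K' : Gluing} (m : TwoThree K K') : K.Flag → K'.Flag → Prop :=
  biCorr m.two m.three m.e

/-- A positive quadrilateral `0 → 2` move. The flags `A 0` and `A 1` are two distinct faces
`(a, b, v₀)` and `(a, b, v₁)` with the common edge `(a, b)`, seen from the same side of the
quadrilateral: one gets from `A 0` to `A 1` by rotating around the edge. The quadrilateral is opened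
and filled by a pillow made by the tetrahedra `P 0`, `P 1`, both with the vertices
`0 = a, 1 = b, 2 = v₀, 3 = v₁`, which are glued to each other along the two faces that contain
`(v₀, v₁)`; `P 0` is attached to the side of `A 0, A 1`, and `P 1` to the other side. -/
structure ZeroTwo (K K' : Gluing) where
  A : Fin 2 → K.Flag
  rotate : ∃ m : ℕ, A 1 = K.turn ((fun F => K.opp (K.turn F))^[m] (A 0))
  distinct : K.face (A 1) ≠ K.face (A 0) ∧ K.face (A 1) ≠ K.face (K.opp (A 0))
  P : Fin 2 → Fin K'.n
  P_inj : Function.Injective P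
  e : Fin K.n ≃ {j // ∀ s, j ≠ P s}
  glue_inner : ∀ σ : Equiv.Perm (Fin 4), σ 3 = 0 ∨ σ 3 = 1 → K'.opp (P 0, σ) = (P 1, σ)
  glue_side : K'.opp ((e (A 0).1 : Fin K'.n), (A 0).2) = (P 0, 1) ∧
    K'.opp ((e (A 1).1 : Fin K'.n), (A 1).2) = (P 0, Equiv.swap 2 3)
  glue_other_side :
    K'.opp ((e (K.opp (A 0)).1 : Fin K'.n), (K.opp (A 0)).2) = (P 1, 1) ∧
    K'.opp ((e (K.opp (A 1)).1 : Fin K'.n), (K.opp (A 1)).2) = (P 1, Equiv.swap 2 3)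
  glue : ∀ F : K.Flag,
    (∀ j, K.face F ≠ K.face (A j) ∧ K.face F ≠ K.face (K.opp (A j))) →
      K'.opp ((e F.1 : Fin K'.n), F.2) = ((e (K.opp F).1 : Fin K'.n), (K.opp F).2)
  sgn : ∀ i, K'.sgn (e i) = K.sgn i

/-- All faces persist, those of the quadrilateral in two copies, one for each side. -/
def ZeroTwo.corr {K K' : Gluing} (m : ZeroTwo K K') (F : K.Flag) (F' : K'.Flag) : Prop :=
  F' = ((m.e F.1 : Fin K'.n), F.2)

/-- The vertices of a convex planar quadrilateral, in the order of the labels of a pillow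
tetrahedron; the segments `01` and `23` are its diagonals. -/
def quadPos : Fin 4 → (Fin 2 → ℝ) := ![![1, 0], ![-1, 0], ![0, 1], ![0, -1]]

/-! ## Moves of ideal triangulations -/

section Moves

variable {M : Type*} [TopologicalSpace M] [ChartedSpace (EuclideanHalfSpace 3) M]

/-- A continuous family of self maps of the collapsed space that starts at the identity and fixes
the marked points. -/
def IsDeformation (Ψ : unitInterval → Hat M → Hat M) : Prop :=
  Continuous (fun p : unitInterval × Hat M => Ψ p.1 p.2) ∧ Ψ 0 = id ∧
    ∀ t, ∀ p ∈ marked M, Ψ t p = p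

variable {o : Orientation3 (Int M)}

/-- `T'` is isotopic to `T` by an ambient isotopy that fixes the marked points. -/
def IsIsotopic (T T' : IdealTriangulation o) (R : T.K.Flag → T'.K.Flag → Prop) : Prop :=
  ∃ m : Relabelling T.K T'.K, R = m.corr ∧
    ∃ Ψ : unitInterval → Hat M → Hat M, IsDeformation Ψ ∧ (∀ t, IsHomeomorph (Ψ t)) ∧
      ∀ i (x y : Tet), (∀ v, y.1 (m.s i v) = x.1 v) →
        T'.h (T'.K.pt (m.e i) y) = Ψ 1 (T.h (T.K.pt i x))

/-- `T'` is obtained from `T` by a positive `2 → 3` move: the tetrahedra that are not involved are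
the same, and the other ones are the two subdivisions of one bipyramid. -/
def IsTwoThree (T T' : IdealTriangulation o) (R : T.K.Flag → T'.K.Flag → Prop) : Prop :=
  ∃ m : TwoThree T.K T'.K, R = m.corr ∧
    (∀ i (x : Tet), T'.h (T'.K.pt (m.e i) x) = T.h (T.K.pt i x)) ∧
    ∀ a k (x y : Tet),
      ∑ v, x.1 v • biPos (twoName a v) = ∑ v, y.1 v • biPos (threeName k v) →
        T'.h (T'.K.pt (m.three k) y) = T.h (T.K.pt (m.two a) x)

/-- `T'` is obtained from `T` by a positive quadrilateral `0 → 2` move: there is a deformation of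
the collapsed space that is an isotopy before time `1` and at time `1` flattens the pillow of `T'`
onto the quadrilateral, so that `T'` becomes `T`. -/
def IsZeroTwo (T T' : IdealTriangulation o) (R : T.K.Flag → T'.K.Flag → Prop) : Prop :=
  ∃ m : ZeroTwo T.K T'.K, R = m.corr ∧
    ∃ Ψ : unitInterval → Hat M → Hat M, IsDeformation Ψ ∧ (∀ t, t < 1 → IsHomeomorph (Ψ t)) ∧
      (∀ i (x : Tet), Ψ 1 (T'.h (T'.K.pt (m.e i) x)) = T.h (T.K.pt i x)) ∧
      ∀ s j (x y : Tet), x.1 ((m.A j).2 3) = 0 →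
        ∑ p, x.1 ((m.A j).2 p) • quadPos ((![1, Equiv.swap 2 3] j : Equiv.Perm (Fin 4)) p) =
          ∑ v, y.1 v • quadPos v →
        Ψ 1 (T'.h (T'.K.pt (m.P s) y)) = T.h (T.K.pt (m.A j).1 x)

/-- An isotopy or a positive ideal move, with the correspondence of the persistent faces. -/
def NakedStep (T T' : IdealTriangulation o) (R : T.K.Flag → T'.K.Flag → Prop) : Prop :=
  IsIsotopic T T' R ∨ IsTwoThree T T' R ∨ IsZeroTwo T T' R

/-! ## Decorated transits and their quotient sets -/

variable (o)

/-- Branched ideal triangulations. -/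
abbrev BranchedTri : Type _ := Σ T : IdealTriangulation o, Branching T.K

/-- Pre-branched ideal triangulations. -/
abbrev PreBranchedTri : Type _ := Σ T : IdealTriangulation o, PreBranching T.K

variable {o}

/-- A decorated isotopy or a positive ideal `b`-transit: the branchings agree at the persistent
edges. -/
def BStep (x y : BranchedTri o) : Prop :=
  ∃ R, NakedStep x.1 y.1 R ∧ ∀ F F', R F F' → ∀ p q : Fin 4, p ≠ 3 → q ≠ 3 →
    (x.2.ord F.1 (F.2 p) < x.2.ord F.1 (F.2 q) ↔
      y.2.ord F'.1 (F'.2 p) < y.2.ord F'.1 (F'.2 q))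

/-- A decorated isotopy or a positive ideal `pb`-transit: the transverse orientations agree at the
persistent faces. -/
def PBStep (x y : PreBranchedTri o) : Prop :=
  ∃ R, NakedStep x.1 y.1 R ∧ ∀ F F', R F F' → x.2.dir F.1 (F.2 3) = y.2.dir F'.1 (F'.2 3)

variable (o)

/-- Branched ideal triangulations up to the equivalence generated by isotopy and ideal
`b`-transits. -/
def BId : Type _ := Quot (BStep (o := o))

/-- Pre-branched ideal triangulations up to the equivalence generated by isotopy and ideal
`pb`-transits. -/
def PBId : Type _ := Quot (PBStep (o := o))

variable {o}

/-- The class of a branched ideal triangulation. -/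
def BId.mk (T : IdealTriangulation o) (b : Branching T.K) : BId o := Quot.mk _ ⟨T, b⟩

/-- The class of a pre-branched ideal triangulation. -/
def PBId.mk (T : IdealTriangulation o) (w : PreBranching T.K) : PBId o := Quot.mk _ ⟨T, w⟩

theorem NakedStep.sgn {T T' : IdealTriangulation o} {R : T.K.Flag → T'.K.Flag → Prop}
    (h : NakedStep T T' R) (F : T.K.Flag) (F' : T'.K.Flag) (hF : R F F') :
    T.K.sgn F.1 * Equiv.Perm.sign F.2 = T'.K.sgn F'.1 * Equiv.Perm.sign F'.2 := by
  rcases h with ⟨m, rfl, _⟩ | ⟨m, rfl, _⟩ | ⟨m, rfl, _⟩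
  · rw [show F' = _ from hF]
    simp only [m.sgn, Equiv.Perm.sign_mul]
    have h1 := Int.units_mul_self (Equiv.Perm.sign (m.s F.1))
    calc T.K.sgn F.1 * Equiv.Perm.sign F.2
        = (Equiv.Perm.sign (m.s F.1) * Equiv.Perm.sign (m.s F.1)) *
            (T.K.sgn F.1 * Equiv.Perm.sign F.2) := by rw [h1, one_mul]
      _ = _ := by simp only [mul_comm, mul_left_comm]
  · exact m.sgn F F' hF
  · rw [show F' = _ from hF]
    simp only [m.sgn]

/-- A `b`-transit induces a `pb`-transit. -/
theorem BStep.toPre {x y : BranchedTri o} (h : BStep x y) :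
    PBStep (o := o) ⟨x.1, x.2.toPre⟩ ⟨y.1, y.2.toPre⟩ := by
  obtain ⟨R, hR, hb⟩ := h
  refine ⟨R, hR, fun F F' hF => ?_⟩
  have hs := hR.sgn F F' hF
  have key := bdry_transport (x.2.ord F.1) (y.2.ord F'.1) (F'.2 * F.2⁻¹) (F.2 3) (by
    intro u v hu hv
    have h := hb F F' hF (F.2⁻¹ u) (F.2⁻¹ v)
      (fun h => hu (by rw [← h]; simp)) (fun h => hv (by rw [← h]; simp))
    simpa using h)
  rw [show (F'.2 * F.2⁻¹) (F.2 3) = F'.2 3 by simp, Equiv.Perm.sign_mul,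
    Equiv.Perm.sign_inv] at key
  change (x.1.K.sgn F.1 : ℤ) * bdry (x.2.ord F.1) (F.2 3) =
    (y.1.K.sgn F'.1 : ℤ) * bdry (y.2.ord F'.1) (F'.2 3)
  have hx : x.1.K.sgn F.1 =
      y.1.K.sgn F'.1 * (Equiv.Perm.sign F'.2 * Equiv.Perm.sign F.2) := by
    rw [← mul_assoc, ← hs, mul_assoc, Int.units_mul_self, mul_one]
  rw [key, hx]
  push_cast
  ring

/-- The forgetting map `[(T, b)] ↦ [(T, ω_b)]`. -/
def forgetting (o : Orientation3 (Int M)) : BId o → PBId o :=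
  Quot.map (fun x : BranchedTri o => (⟨x.1, x.2.toPre⟩ : PreBranchedTri o))
    (fun _ _ h => h.toPre)

end Moves

end IdealTri

/-! A pre-branching is closed: at each tetrahedron two dual edges go in and two go out, so its
signed values on the four faces sum to zero. If it is $\omega_b$, it is moreover the coboundary of
the 1-cochain equal to $1$ on every $b$-oriented edge: an acyclic triangle has circulation $\pm1$,
with the prevailing sign. This cochain is odd on every edge, and oddness is what survives the moves.

Conversely, let $c$ be an odd cochain with coboundary $\omega$ (`IsOddPotential`). It never vanishes
on an edge, and no face is cyclic for its sign, since three positive odd integers add up to at least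
$3$ while the coboundary is $\pm1$. So the sign of $c$ is a branching $b$
(`IsOddPotential.exists_branching`). In general $\omega_b$ need not be $\omega$: they disagree on a
face whose edges have the values $1, 1, 3$.

Odd potentials move along every $pb$-transit in both directions, keeping their values on persistent
edges (`NakedStep.push_potential`, `NakedStep.pull_potential`). In a positive move the value on the
new edge is forced by one new face and is odd, being a sum of three odd numbers with signs; the
other new faces follow because both sides are closed. In a negative move the values restrict. Hence
the signs of the two potentials are related by a $b$-transit, and having an odd potential whose sign
lies in a given class $\beta$ depends only on the $pb$-class (`PBStep.hasPotentialOver_iff`).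

If now $[(T,\omega)]=\phi(\beta)$, start from a representative $(T',b')$ of $\beta$ with its unit
cochain. The property holds for $(T',\omega_{b'})$, hence for $(T,\omega)$, which gives a branching
$b$ on $T$ of class $\beta$; then $[(T,\omega_b)]=\phi(\beta)=[(T,\omega)]$. The other implication
is immediate. -/

namespace IdealTri

/-! ## Edge cochains and their coboundaries -/

/-- An integer for every ordered pair of vertices of every abstract tetrahedron. -/
abbrev EdgeCochain (K : Gluing) : Type := Fin K.n → Fin 4 → Fin 4 → ℤ

/-- The circulation of a cochain along the boundary of the ordered face `σ 0, σ 1, σ 2`. -/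
def circ (c : Fin 4 → Fin 4 → ℤ) (σ : Equiv.Perm (Fin 4)) : ℤ :=
  c (σ 0) (σ 1) + c (σ 1) (σ 2) + c (σ 2) (σ 0)

/-- Two cochains agree on the edges of two ordered faces. -/
def AgreeAt {K K' : Gluing} (c : EdgeCochain K) (F : K.Flag) (c' : EdgeCochain K')
    (F' : K'.Flag) : Prop :=
  ∀ p q : Fin 4, p ≠ 3 → q ≠ 3 → c F.1 (F.2 p) (F.2 q) = c' F'.1 (F'.2 p) (F'.2 q)

/-- At the face `F`, the coboundary of the cochain is the transverse orientation. -/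
def CobAt {K : Gluing} (w : PreBranching K) (c : EdgeCochain K) (F : K.Flag) : Prop :=
  circ (c F.1) F.2 = K.sgn F.1 * Equiv.Perm.sign F.2 * w.dir F.1 (F.2 3)

/-- An odd potential of a pre-branching: an odd cochain on the edges of the triangulation whose
coboundary is the pre-branching. -/
structure IsOddPotential {K : Gluing} (w : PreBranching K) (c : EdgeCochain K) : Prop where
  antisymm : ∀ i u v, c i v u = - c i u v
  odd : ∀ i u v, u ≠ v → Odd (c i u v)
  glue : ∀ F : K.Flag, AgreeAt c F c (K.opp F)
  cob : ∀ F : K.Flag, CobAt w c F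

/-! ### Propagation of agreement and of the coboundary condition across faces and tetrahedra -/

theorem Gluing.opp_opp (K : Gluing) (F : K.Flag) : K.opp (K.opp F) = F := by
  obtain ⟨i, σ⟩ := F
  simp only [opp, Equiv.Perm.mul_apply, K.adj_adj, K.perm_perm, inv_mul_cancel_left]

theorem Gluing.opp_mul (K : Gluing) (F : K.Flag) (τ : Equiv.Perm (Fin 4)) (h : τ 3 = 3) :
    K.opp (F.1, F.2 * τ) = ((K.opp F).1, (K.opp F).2 * τ) := by
  simp [opp, h, mul_assoc]

theorem apply_three_of_face_eq {σ σ' : Equiv.Perm (Fin 4)} (h : σ 3 = σ' 3) :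
    (σ⁻¹ * σ') 3 = 3 := by
  rw [Equiv.Perm.mul_apply, ← h]
  simp

section Agree

variable {K K' K'' : Gluing} {c : EdgeCochain K} {c' : EdgeCochain K'} {c'' : EdgeCochain K''}
  {F : K.Flag} {F' : K'.Flag} {F'' : K''.Flag}

theorem AgreeAt.symm (h : AgreeAt c F c' F') : AgreeAt c' F' c F :=
  fun p q hp hq => (h p q hp hq).symm

theorem AgreeAt.trans (h : AgreeAt c F c' F') (h' : AgreeAt c' F' c'' F'') :
    AgreeAt c F c'' F'' :=
  fun p q hp hq => (h p q hp hq).trans (h' p q hp hq)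

theorem AgreeAt.mul (h : AgreeAt c F c' F') (τ : Equiv.Perm (Fin 4)) (hτ : τ 3 = 3) :
    AgreeAt c (F.1, F.2 * τ) c' (F'.1, F'.2 * τ) := by
  intro p q hp hq
  have ne : ∀ p : Fin 4, p ≠ 3 → τ p ≠ 3 := fun p hp h =>
    hp (τ.injective (h.trans hτ.symm))
  exact h (τ p) (τ q) (ne p hp) (ne q hq)

/-- Compatibility with the gluing at one ordering of a face gives it at all of them. -/
theorem AgreeAt.opp_of_face_eq (h : AgreeAt c F c (K.opp F)) (σ : Equiv.Perm (Fin 4))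
    (hσ : σ 3 = F.2 3) : AgreeAt c (F.1, σ) c (K.opp (F.1, σ)) := by
  have hτ := apply_three_of_face_eq hσ.symm
  have h1 := h.mul _ hτ
  rw [← K.opp_mul F _ hτ, mul_inv_cancel_left] at h1
  exact h1

theorem agreeAt_opp_opp (h : AgreeAt c F c (K.opp F)) :
    AgreeAt c (K.opp F) c (K.opp (K.opp F)) := by
  rw [K.opp_opp]; exact h.symm

theorem AgreeAt.circ_eq (h : AgreeAt c F c' F') : circ (c F.1) F.2 = circ (c' F'.1) F'.2 := by
  unfold circ
  rw [h 0 1 (by decide) (by decide), h 1 2 (by decide) (by decide),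
    h 2 0 (by decide) (by decide)]

theorem CobAt.of_agree {w : PreBranching K} {w' : PreBranching K'} (h : CobAt w c F)
    (ha : AgreeAt c F c' F')
    (hs : K.sgn F.1 * Equiv.Perm.sign F.2 = K'.sgn F'.1 * Equiv.Perm.sign F'.2)
    (hd : w.dir F.1 (F.2 3) = w'.dir F'.1 (F'.2 3)) : CobAt w' c' F' := by
  have hs' := congrArg (Units.val : ℤˣ → ℤ) hs
  push_cast at hs'
  unfold CobAt
  rw [← ha.circ_eq, ← hs', ← hd]
  exact h

/-- Crossing a face reverses both the orientation sign of the flag and the direction of the dual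
edge, so their product is unchanged. -/
theorem CobAt.opp {w : PreBranching K} (h : CobAt w c F) (ha : AgreeAt c F c (K.opp F)) :
    CobAt w c (K.opp F) := by
  unfold CobAt at *
  rw [← ha.circ_eq, h]
  simp only [Gluing.opp, Equiv.Perm.mul_apply, w.glue, K.sgn_adj, Equiv.Perm.sign_mul]
  have h2 : ((Equiv.Perm.sign (K.perm F.1 (F.2 3)) : ℤˣ) : ℤ) *
      (Equiv.Perm.sign (K.perm F.1 (F.2 3)) : ℤˣ) = 1 := by
    rw [← Units.val_mul, Int.units_mul_self]; rfl
  push_cast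
  linear_combination
    (-(K.sgn F.1 : ℤ) * Equiv.Perm.sign F.2 * w.dir F.1 (F.2 3)) * h2

theorem circ_mul {d : Fin 4 → Fin 4 → ℤ} (hd : ∀ u v, d v u = - d u v)
    (σ τ : Equiv.Perm (Fin 4)) (hτ : τ 3 = 3) :
    circ d (σ * τ) = Equiv.Perm.sign τ * circ d σ := by
  have key : ∀ τ : Equiv.Perm (Fin 4), τ 3 = 3 →
      ((τ 0 = 0 ∧ τ 1 = 1 ∧ τ 2 = 2 ∨ τ 0 = 1 ∧ τ 1 = 2 ∧ τ 2 = 0 ∨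
        τ 0 = 2 ∧ τ 1 = 0 ∧ τ 2 = 1) ∧ Equiv.Perm.sign τ = 1) ∨
      ((τ 0 = 1 ∧ τ 1 = 0 ∧ τ 2 = 2 ∨ τ 0 = 0 ∧ τ 1 = 2 ∧ τ 2 = 1 ∨
        τ 0 = 2 ∧ τ 1 = 1 ∧ τ 2 = 0) ∧ Equiv.Perm.sign τ = -1) := by decide +kernel
  simp only [circ, Equiv.Perm.mul_apply]
  have h1 := hd (σ 0) (σ 1)
  have h2 := hd (σ 1) (σ 2)
  have h3 := hd (σ 2) (σ 0)
  rcases key τ hτ with ⟨⟨a, b, e⟩ | ⟨a, b, e⟩ | ⟨a, b, e⟩, hs⟩ |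
    ⟨⟨a, b, e⟩ | ⟨a, b, e⟩ | ⟨a, b, e⟩, hs⟩ <;> rw [a, b, e, hs] <;> push_cast <;> linarith

/-- The coboundary condition at one ordering of a face gives it at all of them. -/
theorem CobAt.of_face_eq {w : PreBranching K} (hc : ∀ u v, c F.1 v u = - c F.1 u v)
    (h : CobAt w c F) (σ : Equiv.Perm (Fin 4)) (hσ : σ 3 = F.2 3) : CobAt w c (F.1, σ) := by
  have hτ := apply_three_of_face_eq hσ.symm
  have h1 := circ_mul hc F.2 (F.2⁻¹ * σ) hτ
  unfold CobAt at *
  rw [mul_inv_cancel_left] at h1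
  rw [h1, h, hσ]
  have h2 : (Equiv.Perm.sign (F.2⁻¹ * σ) : ℤ) * Equiv.Perm.sign F.2 = Equiv.Perm.sign σ := by
    rw [← Units.val_mul, mul_comm, ← Equiv.Perm.sign_mul, mul_inv_cancel_left]
  rw [← h2]
  ring

end Agree

/-- This is the closedness of a pre-branching as a 2-cochain, the only consequence of the two-in,
two-out condition that the moves need. -/
theorem PreBranching.sum_dir {K : Gluing} (w : PreBranching K) (i : Fin K.n) :
    ∑ f, w.dir i f = 0 := by
  have h : ∀ f, w.dir i f =
      (if w.dir i f = 1 then 1 else 0) - (if w.dir i f = -1 then 1 else 0) := by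
    intro f
    rcases w.unit i f with h | h <;> rw [h] <;> norm_num
  rw [Finset.sum_congr rfl fun f _ => h f, Finset.sum_sub_distrib, Finset.sum_boole,
    Finset.sum_boole, w.ingoing, w.outgoing]
  norm_num

/-- In a tetrahedron the coboundary condition at three faces gives it at the fourth one. -/
theorem CobAt.of_other_faces {K : Gluing} {w : PreBranching K} {c : EdgeCochain K} {i : Fin K.n}
    (hc : ∀ u v, c i v u = - c i u v) (σ : Equiv.Perm (Fin 4))
    (h : ∀ τ : Equiv.Perm (Fin 4), τ 3 ≠ σ 3 → CobAt w c (i, τ)) : CobAt w c (i, σ) := by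
  have hs : ∀ j : Fin 4, j ≠ 3 → circ (c i) (σ * Equiv.swap 3 j) =
      - (K.sgn i * Equiv.Perm.sign σ * w.dir i (σ j)) := by
    intro j hj
    have h1 := h (σ * Equiv.swap 3 j) (by simpa using hj)
    unfold CobAt at h1
    simp only at h1
    rw [h1, Equiv.Perm.sign_mul, Equiv.Perm.sign_swap hj.symm]
    simp
  have h0 := hs 0 (by decide)
  have h1 := hs 1 (by decide)
  have h2 := hs 2 (by decide)
  have hsum := Equiv.sum_comp σ (w.dir i)
  rw [w.sum_dir, Fin.sum_univ_four] at hsum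
  have e1 : ∀ p : Fin 4, (Equiv.swap 3 1 : Equiv.Perm (Fin 4)) p = ![0, 3, 2, 1] p := by decide
  have e2 : ∀ p : Fin 4, (Equiv.swap 3 2 : Equiv.Perm (Fin 4)) p = ![0, 1, 3, 2] p := by decide
  have e0 : ∀ p : Fin 4, (Equiv.swap 3 0 : Equiv.Perm (Fin 4)) p = ![3, 1, 2, 0] p := by decide
  simp only [circ, Equiv.Perm.mul_apply, e0, e1, e2, Matrix.cons_val] at h0 h1 h2
  unfold CobAt
  simp only [circ]
  have a1 := hc (σ 3) (σ 1)
  have a2 := hc (σ 3) (σ 2)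
  have a3 := hc (σ 3) (σ 0)
  -- In the sum of the three circulations the edges at `σ 3` cancel in pairs and the boundary of the
  -- fourth face remains; the directions satisfy the same relation by `hsum`.
  linear_combination h0 + h1 + h2 - a1 - a2 - a3 - (K.sgn i * Equiv.Perm.sign σ : ℤ) * hsum

/-! ## Branchings and odd potentials -/

/-- A branching is the sign of a cochain. -/
def IsSignOf {K : Gluing} (b : Branching K) (c : EdgeCochain K) : Prop :=
  ∀ i u v, b.ord i u < b.ord i v ↔ 0 < c i u v

/-- The cochain with value `1` on the oriented edges. -/
def Branching.cochain {K : Gluing} (b : Branching K) : EdgeCochain K := fun i u v =>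
  if b.ord i u < b.ord i v then 1 else if b.ord i v < b.ord i u then -1 else 0

theorem Branching.isSignOf_cochain {K : Gluing} (b : Branching K) : IsSignOf b b.cochain := by
  intro i u v
  unfold cochain
  split_ifs with h h' <;> simp [h]

theorem Branching.glue_flag {K : Gluing} (b : Branching K) (F : K.Flag) (p q : Fin 4)
    (hp : p ≠ 3) (hq : q ≠ 3) : b.ord F.1 (F.2 p) < b.ord F.1 (F.2 q) ↔
      b.ord (K.opp F).1 ((K.opp F).2 p) < b.ord (K.opp F).1 ((K.opp F).2 q) :=
  b.glue F.1 (F.2 3) (F.2 p) (F.2 q) (fun h => hp (F.2.injective h))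
    (fun h => hq (F.2.injective h))

/-- A face is never cyclic for a total order, so one of the three unit terms cancels another and the
prevailing sign remains. Both sides depend on `r` and `σ` only through `r * σ` and signs, which
reduces the check to the standard order. -/
theorem circ_order (r σ : Equiv.Perm (Fin 4)) :
    circ (fun u v => if r u < r v then 1 else if r v < r u then -1 else 0) σ =
      Equiv.Perm.sign σ * bdry r (σ 3) := by
  rw [bdry_eq, ← mul_assoc, ← Units.val_mul, mul_comm (Equiv.Perm.sign σ),
    ← Equiv.Perm.sign_mul, ← Equiv.Perm.mul_apply]
  have key : ∀ ρ : Equiv.Perm (Fin 4),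
      circ (fun u v => if u < v then 1 else if v < u then -1 else 0) ρ =
        Equiv.Perm.sign ρ * ![-1, 1, -1, 1] (ρ 3) := by decide +kernel
  exact key (r * σ)

/-- The starting point of the transport: an induced pre-branching is the coboundary of the unit
cochain of its branching. -/
theorem Branching.isOddPotential_cochain {K : Gluing} (b : Branching K) :
    IsOddPotential b.toPre b.cochain where
  antisymm i u v := by
    unfold cochain
    split_ifs with h h' <;> first | rfl | exact absurd h (lt_asymm h')
  odd i u v huv := by
    unfold cochain
    rcases lt_or_gt_of_ne (fun h => huv ((b.ord i).injective h)) with h | h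
    · rw [if_pos h]; decide
    · rw [if_neg (lt_asymm h), if_pos h]; decide
  glue F p q hp hq := by
    unfold cochain
    simp only [b.glue_flag F p q hp hq, b.glue_flag F q p hq hp]
  cob F := by
    have h := circ_order (b.ord F.1) F.2
    have h2 : (K.sgn F.1 : ℤ) * K.sgn F.1 = 1 := by
      rw [← Units.val_mul, Int.units_mul_self]; rfl
    change circ (b.cochain F.1) F.2 = K.sgn F.1 * Equiv.Perm.sign F.2 *
      (K.sgn F.1 * bdry (b.ord F.1) (F.2 3))
    rw [show circ (b.cochain F.1) F.2 = _ from h]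
    linear_combination (-(Equiv.Perm.sign F.2 : ℤ) * bdry (b.ord F.1) (F.2 3)) * h2

/-- A transitive tournament on four vertices is a total ordering. -/
theorem exists_perm_lt_iff {r : Fin 4 → Fin 4 → Prop} (irrefl : ∀ u, ¬ r u u)
    (total : ∀ u v, u ≠ v → r u v ∨ r v u) (trans : ∀ u v w, r u v → r v w → r u w) :
    ∃ π : Equiv.Perm (Fin 4), ∀ u v, π u < π v ↔ r u v := by
  classical
  -- The position of a vertex will be the number of vertices below it.
  let s : Fin 4 → Finset (Fin 4) := fun v => Finset.univ.filter fun u => r u v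
  have hlt : ∀ v, (s v).card < 4 := fun v => by
    have := Finset.card_lt_card (s := s v) (t := Finset.univ)
      (Finset.ssubset_univ_iff.2 fun h => irrefl v (by
        have := Finset.mem_univ v
        rw [← h] at this
        simpa [s] using this))
    simpa using this
  have mono : ∀ u v, r u v → (s u).card < (s v).card := fun u v h => by
    refine Finset.card_lt_card ⟨fun x hx => ?_, fun hsub => irrefl u ?_⟩
    · simp only [s, Finset.mem_filter, Finset.mem_univ, true_and] at hx ⊢
      exact trans _ _ _ hx h
    · have := hsub (show u ∈ s v by simpa [s] using h)
      simpa [s] using this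
  let g : Fin 4 → Fin 4 := fun v => ⟨(s v).card, hlt v⟩
  have hg : Function.Injective g := fun u v h => by
    by_contra huv
    have h' : (s u).card = (s v).card := congrArg Fin.val h
    rcases total u v huv with h1 | h1
    · exact (mono _ _ h1).ne h'
    · exact (mono _ _ h1).ne' h'
  refine ⟨Equiv.ofBijective g (Finite.injective_iff_bijective.1 hg), fun u v => ?_⟩
  refine ⟨fun h => ?_, fun h => mono u v h⟩
  have h : (s u).card < (s v).card := h
  have huv : u ≠ v := fun e => by rw [e] at h; exact lt_irrefl _ h
  exact (total u v huv).resolve_right fun h1 => lt_asymm h (mono _ _ h1)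

theorem exists_perm_of_ne {u v w : Fin 4} (h1 : u ≠ v) (h2 : v ≠ w) (h3 : u ≠ w) :
    ∃ σ : Equiv.Perm (Fin 4), σ 0 = u ∧ σ 1 = v ∧ σ 2 = w := by
  revert u v w; decide +kernel

/-- The sign of an odd potential is a branching, since no face can be cyclic. -/
theorem IsOddPotential.exists_branching {K : Gluing} {w : PreBranching K} {c : EdgeCochain K}
    (h : IsOddPotential w c) : ∃ b : Branching K, IsSignOf b c := by
  have hz : ∀ i u, c i u u = 0 := fun i u => by have := h.antisymm i u u; omega
  have hne : ∀ i u v, u ≠ v → c i u v ≠ 0 := fun i u v huv e => by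
    have := h.odd i u v huv
    rw [e] at this
    exact absurd this (by decide)
  have ex : ∀ i, ∃ π : Equiv.Perm (Fin 4), ∀ u v, π u < π v ↔ 0 < c i u v := by
    intro i
    refine exists_perm_lt_iff (fun u => by rw [hz]; exact lt_irrefl 0) (fun u v huv => ?_)
      fun u v x h1 h2 => ?_
    · have := hne i u v huv
      have := h.antisymm i u v
      omega
    · have a1 := h.antisymm i u v
      have a2 := h.antisymm i u x
      have huv : u ≠ v := fun e => by rw [e, hz] at h1; exact lt_irrefl _ h1
      have hvx : v ≠ x := fun e => by rw [e, hz] at h2; exact lt_irrefl _ h2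
      have hux : u ≠ x := fun e => by rw [← e] at h2; omega
      have := hne i u x hux
      obtain ⟨σ, rfl, rfl, rfl⟩ := exists_perm_of_ne huv hvx hux
      have hcob := h.cob (i, σ)
      simp only [CobAt, circ] at hcob
      -- If `c i u x` were negative, the face would be cyclic with three positive values, and its
      -- circulation would be at least 3; the coboundary is at most 1.
      have hle : (K.sgn i : ℤ) * Equiv.Perm.sign σ * w.dir i (σ 3) ≤ 1 := by
        rcases Int.units_eq_one_or (K.sgn i) with h | h <;>
        rcases Int.units_eq_one_or (Equiv.Perm.sign σ) with h' | h' <;>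
        rcases w.unit i (σ 3) with h'' | h'' <;> rw [h, h', h''] <;> decide
      omega
  choose π hπ using ex
  refine ⟨⟨π, fun i f u v hu hv => ?_⟩, hπ⟩
  rw [hπ, hπ]
  -- Since `Equiv.swap 3 f` sends `3` to `f`, it is an ordering of the face `f`.
  have hg := h.glue (i, Equiv.swap 3 f) (Equiv.swap 3 f u) (Equiv.swap 3 f v)
    (fun e => hu (by rw [Equiv.swap_apply_eq_iff] at e; simpa using e))
    (fun e => hv (by rw [Equiv.swap_apply_eq_iff] at e; simpa using e))
  simp only [Gluing.opp, Equiv.swap_apply_left, Equiv.Perm.mul_apply,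
    Equiv.swap_apply_self] at hg
  simp [hg]

/-! ## Odd potentials along naked moves -/

theorem IsOddPotential.self_eq_zero {K : Gluing} {w : PreBranching K} {c : EdgeCochain K}
    (h : IsOddPotential w c) (i : Fin K.n) (u : Fin 4) : c i u u = 0 := by
  have := h.antisymm i u u
  omega

theorem odd_unit_mul_dir {K : Gluing} (w : PreBranching K) (s t : ℤˣ) (i : Fin K.n)
    (f : Fin 4) : Odd ((s : ℤ) * t * w.dir i f) := by
  rcases Int.units_eq_one_or s with h | h <;> rcases Int.units_eq_one_or t with h' | h' <;>
  rcases w.unit i f with h'' | h'' <;> rw [h, h', h''] <;> decide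

theorem PreBranching.dir_opp {K : Gluing} (w : PreBranching K) (F : K.Flag) :
    w.dir (K.opp F).1 ((K.opp F).2 3) = - w.dir F.1 (F.2 3) :=
  w.glue F.1 (F.2 3)

theorem Gluing.sgn_opp (K : Gluing) (F : K.Flag) :
    K.sgn (K.opp F).1 * Equiv.Perm.sign (K.opp F).2 = - (K.sgn F.1 * Equiv.Perm.sign F.2) := by
  simp only [opp, K.sgn_adj, Equiv.Perm.sign_mul]
  have h := Int.units_mul_self (Equiv.Perm.sign (K.perm F.1 (F.2 3)))
  calc -(Equiv.Perm.sign (K.perm F.1 (F.2 3)) * K.sgn F.1) *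
        (Equiv.Perm.sign (K.perm F.1 (F.2 3)) * Equiv.Perm.sign F.2)
      = -((Equiv.Perm.sign (K.perm F.1 (F.2 3)) * Equiv.Perm.sign (K.perm F.1 (F.2 3))) *
          (K.sgn F.1 * Equiv.Perm.sign F.2)) := by
        rw [neg_mul]; simp only [mul_comm, mul_left_comm]
    _ = _ := by rw [h, one_mul]

theorem agreeAt_of_corr {K K' : Gluing} {c : EdgeCochain K} {c' : EdgeCochain K'} {F : K.Flag}
    {F' : K'.Flag} (h : AgreeAt c F c' F') (ho : AgreeAt c (K.opp F) c' (K'.opp F'))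
    (hg : AgreeAt c F c (K.opp F)) : AgreeAt c' F' c' (K'.opp F') :=
  (h.symm.trans hg).trans ho

/-- For a move, `t` lists the tetrahedra on one side that are involved and `e` identifies the
remaining ones, so a cochain can be prescribed separately on the two kinds. -/
theorem exists_extension {α X : Type*} {m n' : ℕ} {t : Fin m → Fin n'}
    (ht : Function.Injective t) (e : α ≃ {j // ∀ k, j ≠ t k}) (g : α → X) (h : Fin m → X) :
    ∃ c : Fin n' → X, (∀ i, c (e i) = g i) ∧ ∀ k, c (t k) = h k := by
  classical
  refine ⟨fun j => if hj : ∃ k, j = t k then h hj.choose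
    else g (e.symm ⟨j, fun k hk => hj ⟨k, hk⟩⟩), fun i => ?_, fun k => ?_⟩
  · have hi : ¬ ∃ k, (e i : Fin n') = t k := fun ⟨k, hk⟩ => (e i).2 k hk
    simp [hi]
  · have hk : ∃ k', t k = t k' := ⟨k, rfl⟩
    simp only [dif_pos hk]
    rw [ht hk.choose_spec.symm]

theorem eq_or_eq_of_equiv {α : Type*} {m n' : ℕ} {t : Fin m → Fin n'}
    (e : α ≃ {j // ∀ k, j ≠ t k}) (j : Fin n') : (∃ i, j = e i) ∨ ∃ k, j = t k := by
  by_cases hj : ∃ k, j = t k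
  · exact Or.inr hj
  · exact Or.inl ⟨e.symm ⟨j, fun k hk => hj ⟨k, hk⟩⟩, by simp⟩

/-! ### Relabellings -/

theorem Relabelling.exists_flag {K K' : Gluing} (m : Relabelling K K') (F' : K'.Flag) :
    ∃ F : K.Flag, F' = (m.e F.1, m.s F.1 * F.2) :=
  ⟨(m.e.symm F'.1, (m.s (m.e.symm F'.1))⁻¹ * F'.2), by simp⟩

theorem Relabelling.sgn_eq {K K' : Gluing} (m : Relabelling K K') (F : K.Flag) :
    K.sgn F.1 * Equiv.Perm.sign F.2 =
      K'.sgn (m.e F.1) * Equiv.Perm.sign (m.s F.1 * F.2) := by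
  have h := Int.units_mul_self (Equiv.Perm.sign (m.s F.1))
  rw [m.sgn, Equiv.Perm.sign_mul, mul_mul_mul_comm, h, one_mul]

theorem Relabelling.push_potential {K K' : Gluing} (m : Relabelling K K') {w : PreBranching K}
    {w' : PreBranching K'} {c : EdgeCochain K} (hc : IsOddPotential w c)
    (hd : ∀ F F', m.corr F F' → w.dir F.1 (F.2 3) = w'.dir F'.1 (F'.2 3)) :
    ∃ c', IsOddPotential w' c' ∧ ∀ F F', m.corr F F' → AgreeAt c F c' F' := by
  let c' : EdgeCochain K' := fun j u v =>
    c (m.e.symm j) ((m.s (m.e.symm j))⁻¹ u) ((m.s (m.e.symm j))⁻¹ v)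
  have ha : ∀ F : K.Flag, AgreeAt c F c' (m.e F.1, m.s F.1 * F.2) := by
    intro F p q _ _
    simp [c']
  refine ⟨c', ⟨fun i u v => hc.antisymm _ _ _, fun i u v huv => hc.odd _ _ _ ?_, ?_, ?_⟩, ?_⟩
  · exact fun h => huv ((m.s _)⁻¹.injective h)
  · intro F'
    obtain ⟨F, rfl⟩ := m.exists_flag F'
    refine agreeAt_of_corr (ha F) ?_ (hc.glue F)
    rw [m.glue F]
    exact ha _
  · intro F'
    obtain ⟨F, rfl⟩ := m.exists_flag F'
    exact (hc.cob F).of_agree (ha F) (m.sgn_eq F) (hd F _ rfl)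
  · rintro F _ rfl
    exact ha F

theorem Relabelling.pull_potential {K K' : Gluing} (m : Relabelling K K') {w : PreBranching K}
    {w' : PreBranching K'} {c' : EdgeCochain K'} (hc : IsOddPotential w' c')
    (hd : ∀ F F', m.corr F F' → w.dir F.1 (F.2 3) = w'.dir F'.1 (F'.2 3)) :
    ∃ c, IsOddPotential w c ∧ ∀ F F', m.corr F F' → AgreeAt c F c' F' := by
  let c : EdgeCochain K := fun i u v => c' (m.e i) (m.s i u) (m.s i v)
  have ha : ∀ F : K.Flag, AgreeAt c F c' (m.e F.1, m.s F.1 * F.2) := fun F p q _ _ => rfl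
  refine ⟨c, ⟨fun i u v => hc.antisymm _ _ _, fun i u v huv => hc.odd _ _ _ ?_, ?_, ?_⟩, ?_⟩
  · exact fun h => huv ((m.s _).injective h)
  · intro F
    refine agreeAt_of_corr (ha F).symm ?_ (hc.glue _)
    rw [m.glue F]
    exact (ha _).symm
  · intro F
    exact (hc.cob _).of_agree (ha F).symm (m.sgn_eq F).symm (hd F _ rfl).symm
  · rintro F _ rfl
    exact ha F

/-! ### The `2 → 3` move -/

/-- The cochain on the bipyramid that extends the cochains `d 0`, `d 1` on the two tetrahedra and
has the value `x` on the edge between the apices. -/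
def joinTwo (d : Fin 2 → Fin 4 → Fin 4 → ℤ) (x : ℤ) : BiVertex → BiVertex → ℤ
  | .inl a, .inl b => if a < b then x else if b < a then -x else 0
  | .inl a, .inr k => d a 0 k.succ
  | .inr k, .inl a => d a k.succ 0
  | .inr k, .inr l => d 0 k.succ l.succ

theorem joinTwo_antisymm {d : Fin 2 → Fin 4 → Fin 4 → ℤ} (hd : ∀ a u v, d a v u = - d a u v)
    (x : ℤ) (y z : BiVertex) : joinTwo d x z y = - joinTwo d x y z := by
  rcases y with a | k <;> rcases z with b | l
  · rcases lt_trichotomy a b with h | rfl | h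
    · simp [joinTwo, h, lt_asymm h]
    · simp [joinTwo]
    · simp [joinTwo, h, lt_asymm h]
  · exact hd _ _ _
  · exact hd _ _ _
  · exact hd _ _ _

theorem odd_joinTwo {d : Fin 2 → Fin 4 → Fin 4 → ℤ} (hd : ∀ a u v, u ≠ v → Odd (d a u v))
    {x : ℤ} (hx : Odd x) (y z : BiVertex) (hyz : y ≠ z) : Odd (joinTwo d x y z) := by
  rcases y with a | k <;> rcases z with b | l
  · simp only [joinTwo]
    split_ifs with h h'
    · exact hx
    · exact hx.neg
    · exact absurd (congrArg Sum.inl (le_antisymm (not_lt.1 h') (not_lt.1 h))) hyz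
  · exact hd _ _ _ (Fin.succ_ne_zero _).symm
  · exact hd _ _ _ (Fin.succ_ne_zero _)
  · exact hd _ _ _ fun h => hyz (congrArg Sum.inr (Fin.succ_injective _ h))

theorem joinTwo_twoName {d : Fin 2 → Fin 4 → Fin 4 → ℤ} (hz : ∀ a u, d a u u = 0)
    (heq : ∀ a u v, u ≠ 0 → v ≠ 0 → d a u v = d 0 u v) (x : ℤ) (a : Fin 2) (u v : Fin 4) :
    d a u v = joinTwo d x (twoName a u) (twoName a v) := by
  have hs : ∀ k : Fin 3, twoName a k.succ = .inr k := by intro k; fin_cases k <;> rfl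
  have h0 : twoName a 0 = .inl a := rfl
  induction u using Fin.cases with
  | zero =>
    induction v using Fin.cases with
    | zero => simp [h0, joinTwo, hz]
    | succ l => rw [hs, h0]; rfl
  | succ k =>
    induction v using Fin.cases with
    | zero => rw [hs, h0]; rfl
    | succ l => rw [hs, hs]; exact heq _ _ _ (Fin.succ_ne_zero _) (Fin.succ_ne_zero _)

/-- The cochain on the bipyramid that extends the cochains on the three tetrahedra. -/
def joinThree (d : Fin 3 → Fin 4 → Fin 4 → ℤ) : BiVertex → BiVertex → ℤ
  | .inl a, .inl b => if a < b then d 0 0 1 else if b < a then - d 0 0 1 else 0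
  | .inl a, .inr k => d (k + 1) (a.castLE (by decide)) 3
  | .inr k, .inl a => - d (k + 1) (a.castLE (by decide)) 3
  | .inr k, .inr l => if l = k + 1 then d (k + 2) 2 3 else if k = l + 1 then - d (l + 2) 2 3
      else 0

/-- `joinThree` reads each edge of the bipyramid in one chosen tetrahedron. The axis lies in all
three tetrahedra and an edge from an apex to the equator in two; the hypotheses, which come from the
inner gluings, say that the choice does not matter. -/
theorem joinThree_threeName {d : Fin 3 → Fin 4 → Fin 4 → ℤ}
    (hd : ∀ k u v, d k v u = - d k u v) (h01 : ∀ k, d (k + 1) 0 1 = d k 0 1)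
    (h0 : ∀ k, d (k + 1) 0 2 = d k 0 3) (h1 : ∀ k, d (k + 1) 1 2 = d k 1 3)
    (k : Fin 3) (u v : Fin 4) : d k u v = joinThree d (threeName k u) (threeName k v) := by
  have hz : ∀ k u, d k u u = 0 := fun k u => by have := hd k u u; omega
  have a0 : d 1 0 1 = d 0 0 1 := h01 0
  have a1 : d 2 0 1 = d 1 0 1 := h01 1
  have b0 : d 1 0 2 = d 0 0 3 := h0 0
  have b1 : d 2 0 2 = d 1 0 3 := h0 1
  have b2 : d 0 0 2 = d 2 0 3 := h0 2
  have c0 : d 1 1 2 = d 0 1 3 := h1 0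
  have c1 : d 2 1 2 = d 1 1 3 := h1 1
  have c2 : d 0 1 2 = d 2 1 3 := h1 2
  have e0 := hd k 0 1
  have e1 := hd k 0 2
  have e2 := hd k 0 3
  have e3 := hd k 1 2
  have e4 := hd k 1 3
  have e5 := hd k 2 3
  fin_cases k <;> fin_cases u <;> fin_cases v <;>
    simp [joinThree, threeName, hz] at * <;> omega

theorem joinThree_antisymm (d : Fin 3 → Fin 4 → Fin 4 → ℤ) (y z : BiVertex) :
    joinThree d z y = - joinThree d y z := by
  rcases y with a | k <;> rcases z with b | l
  · rcases lt_trichotomy a b with h | rfl | h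
    · simp [joinThree, h, lt_asymm h]
    · simp [joinThree]
    · simp [joinThree, h, lt_asymm h]
  · simp [joinThree]
  · simp [joinThree]
  · fin_cases k <;> fin_cases l <;> simp [joinThree]

theorem odd_joinThree {d : Fin 3 → Fin 4 → Fin 4 → ℤ} (hd : ∀ k u v, u ≠ v → Odd (d k u v))
    (y z : BiVertex) (hyz : y ≠ z) : Odd (joinThree d y z) := by
  have h3 : ∀ a : Fin 2, (a.castLE (by decide) : Fin 4) ≠ 3 := by decide
  rcases y with a | k <;> rcases z with b | l
  · simp only [joinThree]
    split_ifs with h h'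
    · exact hd _ _ _ (by decide)
    · exact (hd _ _ _ (by decide)).neg
    · exact absurd (congrArg Sum.inl (le_antisymm (not_lt.1 h') (not_lt.1 h))) hyz
  · exact hd _ _ _ (h3 a)
  · exact (hd _ _ _ (h3 b)).neg
  · simp only [joinThree]
    split_ifs with h h'
    · exact hd _ _ _ (by decide)
    · exact (hd _ _ _ (by decide)).neg
    · exfalso
      have : ∀ k l : Fin 3, k ≠ l → l ≠ k + 1 → k ≠ l + 1 → False := by decide
      exact this k l (fun e => hyz (congrArg Sum.inr e)) h h'

theorem twoName_injective : ∀ a, Function.Injective (twoName a) := by decide +kernel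

theorem threeName_injective : ∀ k, Function.Injective (threeName k) := by decide +kernel

theorem three_outer_face : ∀ (k : Fin 3) (σ' : Equiv.Perm (Fin 4)),
    (σ' 3 = 0 ∨ σ' 3 = 1) → ∃ (a : Fin 2) (σ : Equiv.Perm (Fin 4)),
      ∀ p, p ≠ 3 → twoName a (σ p) = threeName k (σ' p) := by decide +kernel

theorem three_inner_face : ∀ (k : Fin 3) (σ' : Equiv.Perm (Fin 4)),
    (σ' 3 = 2 ∨ σ' 3 = 3) → ∃ (k' : Fin 3) (σ : Equiv.Perm (Fin 4)), k ≠ k' ∧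
      ∀ p, p ≠ 3 → threeName k (σ' p) = threeName k' (σ p) := by decide +kernel

theorem two_outer_face : ∀ (a : Fin 2) (σ : Equiv.Perm (Fin 4)),
    σ 3 ≠ 0 → ∃ (k : Fin 3) (σ' : Equiv.Perm (Fin 4)),
      ∀ p, p ≠ 3 → twoName a (σ p) = threeName k (σ' p) := by decide +kernel

theorem two_inner_face : ∀ (a : Fin 2) (σ : Equiv.Perm (Fin 4)),
    σ 3 = 0 → ∃ a' : Fin 2, a ≠ a' ∧
      ∀ p, p ≠ 3 → twoName a (σ p) = twoName a' (σ p) := by decide +kernel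

section TwoThree

variable {K K' : Gluing} (m : TwoThree K K')

theorem TwoThree.agreeAt {c : EdgeCochain K} {c' : EdgeCochain K'} {C : BiVertex → BiVertex → ℤ}
    (he : ∀ i, c' (m.e i) = c i)
    (h2 : ∀ a u v, c (m.two a) u v = C (twoName a u) (twoName a v))
    (h3 : ∀ k u v, c' (m.three k) u v = C (threeName k u) (threeName k v))
    (F : K.Flag) (F' : K'.Flag) (h : m.corr F F') : AgreeAt c F c' F' := by
  rcases h with ⟨hi, rfl⟩ | ⟨a, k, h1, h1', hn⟩
  · intro p q _ _
    simp only [he]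
  · intro p q hp hq
    rw [h1, h1', h2, h3, hn p hp, hn q hq]

theorem TwoThree.corr_e (i : {i // ∀ a, i ≠ m.two a}) (σ : Equiv.Perm (Fin 4)) :
    m.corr (i, σ) (m.e i, σ) :=
  Or.inl ⟨i.2, rfl⟩

/-- The six outer faces inherit the coboundary condition. The axis value is fixed by one inner face,
and closedness in each tetrahedron carries the condition around the axis to the other two. -/
theorem TwoThree.push_potential {w : PreBranching K} {w' : PreBranching K'} {c : EdgeCochain K}
    (hc : IsOddPotential w c)
    (hd : ∀ F F', m.corr F F' → w.dir F.1 (F.2 3) = w'.dir F'.1 (F'.2 3)) :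
    ∃ c', IsOddPotential w' c' ∧ ∀ F F', m.corr F F' → AgreeAt c F c' F' := by
  let d : Fin 2 → Fin 4 → Fin 4 → ℤ := fun a => c (m.two a)
  -- Solves the coboundary equation on the inner face with vertices `.inl 0`, `.inl 1`, `.inr 1`,
  -- that is, the flag `(m.three 0, 1)`.
  let x : ℤ := (K'.sgn (m.three 0) : ℤ) * (1 : ℤˣ) * w'.dir (m.three 0) 3 - d 1 0 2 - d 0 2 0
  have hx : Odd x := ((odd_unit_mul_dir w' _ _ _ _).sub_odd
    (hc.odd _ _ _ (by decide))).sub_odd (hc.odd _ _ _ (by decide))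
  have heq : ∀ a u v, u ≠ 0 → v ≠ 0 → d a u v = d 0 u v := by
    have h : ∀ u v, u ≠ 0 → v ≠ 0 → d 0 u v = d 1 u v := by
      intro u v hu hv
      -- `finRotate 4` sends `3` to `0`, so this flag is the equatorial face, opposite to the apex.
      have h := hc.glue (m.two 0, finRotate 4)
      rw [m.glue_two 0 1 (finRotate 4) (finRotate 4) (by decide) (by decide)] at h
      have ne : ∀ u : Fin 4, u ≠ 0 → (finRotate 4).symm u ≠ 3 := by decide
      simpa using h _ _ (ne u hu) (ne v hv)
    intro a u v hu hv
    fin_cases a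
    · rfl
    · exact (h u v hu hv).symm
  let C := joinTwo d x
  have h2 : ∀ a u v, c (m.two a) u v = C (twoName a u) (twoName a v) :=
    joinTwo_twoName (d := d) (fun a u => hc.self_eq_zero _ u) heq x
  obtain ⟨c', he, h3⟩ := exists_extension m.three_inj m.e (fun i => c i)
    (fun k u v => C (threeName k u) (threeName k v))
  replace h3 : ∀ k u v, c' (m.three k) u v = C (threeName k u) (threeName k v) :=
    fun k u v => by rw [h3]
  have ha := m.agreeAt he h2 h3
  have hanti : ∀ i u v, c' i v u = - c' i u v := by
    intro j u v
    rcases eq_or_eq_of_equiv m.e j with ⟨i, rfl⟩ | ⟨k, rfl⟩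
    · rw [he]; exact hc.antisymm _ _ _
    · rw [h3, h3]; exact joinTwo_antisymm (fun a => hc.antisymm _) _ _ _
  have hodd : ∀ i u v, u ≠ v → Odd (c' i u v) := by
    intro j u v huv
    rcases eq_or_eq_of_equiv m.e j with ⟨i, rfl⟩ | ⟨k, rfl⟩
    · rw [he]; exact hc.odd _ _ _ huv
    · rw [h3]
      exact odd_joinTwo (fun a => hc.odd _) hx _ _ fun h => huv (threeName_injective k h)
  have hglue_corr : ∀ F F', m.corr F F' → AgreeAt c' F' c' (K'.opp F') := fun F F' h =>
    agreeAt_of_corr (ha F F' h) (ha _ _ (m.glue F F' h)) (hc.glue F)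
  have hcob_corr : ∀ F F', m.corr F F' → CobAt w' c' F' := fun F F' h =>
    (hc.cob F).of_agree (ha F F' h) (m.sgn F F' h) (hd F F' h)
  have houter : ∀ k (σ' : Equiv.Perm (Fin 4)), (σ' 3 = 0 ∨ σ' 3 = 1) →
      ∃ F, m.corr F (m.three k, σ') := fun k σ' h => by
    obtain ⟨a, σ, hn⟩ := three_outer_face k σ' h
    exact ⟨(m.two a, σ), Or.inr ⟨a, k, rfl, rfl, hn⟩⟩
  have hglue : ∀ F', AgreeAt c' F' c' (K'.opp F') := by
    rintro ⟨j, σ'⟩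
    rcases eq_or_eq_of_equiv m.e j with ⟨i, rfl⟩ | ⟨k, rfl⟩
    · exact hglue_corr _ _ (m.corr_e i σ')
    · by_cases h : σ' 3 = 0 ∨ σ' 3 = 1
      · obtain ⟨F, hF⟩ := houter k σ' h
        exact hglue_corr _ _ hF
      · obtain ⟨k', σ, hk, hn⟩ := three_inner_face k σ' (by omega)
        rw [m.glue_three k k' σ' σ hk hn]
        intro p q hp hq
        simp only [h3, hn p hp, hn q hq]
  have hstart : CobAt w' c' (m.three 0, 1) := by
    simp only [CobAt, circ, h3, Equiv.Perm.one_apply, Equiv.Perm.sign_one]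
    change x + d 1 0 2 + d 0 2 0 = _
    simp only [x]
    ring
  have hside : ∀ k, CobAt w' c' (m.three k, 1) → ∀ σ : Equiv.Perm (Fin 4), σ 3 ≠ 2 →
      CobAt w' c' (m.three k, σ) := by
    intro k hk σ hσ
    by_cases h : σ 3 = 0 ∨ σ 3 = 1
    · obtain ⟨F, hF⟩ := houter k σ h
      exact hcob_corr _ _ hF
    · exact hk.of_face_eq (hanti _) σ (show σ 3 = 3 by omega)
  have hfour : ∀ k, CobAt w' c' (m.three k, 1) → ∀ σ, CobAt w' c' (m.three k, σ) := by
    intro k hk σ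
    by_cases h : σ 3 = 2
    · exact CobAt.of_other_faces (hanti _) σ fun τ hτ => hside k hk τ (by rwa [h] at hτ)
    · exact hside k hk σ h
  -- The face opposite to `2` in `three k` is glued to the face opposite to `3` in `three (k + 1)`.
  have hstep : ∀ k, CobAt w' c' (m.three k, 1) → CobAt w' c' (m.three (k + 1), 1) := by
    intro k hk
    have h := (hfour k hk (Equiv.swap 2 3)).opp (hglue _)
    have hne : ∀ k : Fin 3, k ≠ k + 1 := by decide
    have hn : ∀ (k : Fin 3) (p : Fin 4), p ≠ 3 → threeName k (Equiv.swap 2 3 p) =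
      threeName (k + 1) ((1 : Equiv.Perm (Fin 4)) p) := by decide +kernel
    rwa [m.glue_three k (k + 1) _ 1 (hne k) (hn k)] at h
  have hall : ∀ k, CobAt w' c' (m.three k, 1) := by
    intro k
    fin_cases k
    · exact hstart
    · exact hstep 0 hstart
    · exact hstep 1 (hstep 0 hstart)
  refine ⟨c', ⟨hanti, hodd, hglue, ?_⟩, ha⟩
  rintro ⟨j, σ⟩
  rcases eq_or_eq_of_equiv m.e j with ⟨i, rfl⟩ | ⟨k, rfl⟩
  · exact hcob_corr _ _ (m.corr_e i σ)
  · exact hfour k (hall k) σ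

/-- The axis value is forgotten. The only face of the two tetrahedra that does not persist is the
equatorial one, where the condition follows from the three outer faces of one tetrahedron. -/
theorem TwoThree.pull_potential {w : PreBranching K} {w' : PreBranching K'}
    {c' : EdgeCochain K'} (hc : IsOddPotential w' c')
    (hd : ∀ F F', m.corr F F' → w.dir F.1 (F.2 3) = w'.dir F'.1 (F'.2 3)) :
    ∃ c, IsOddPotential w c ∧ ∀ F F', m.corr F F' → AgreeAt c F c' F' := by
  let d : Fin 3 → Fin 4 → Fin 4 → ℤ := fun k => c' (m.three k)
  let C := joinThree d
  have hinner : ∀ k, AgreeAt c' (m.three k, Equiv.swap 2 3) c' (m.three (k + 1), 1) := by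
    intro k
    have h := hc.glue (m.three k, Equiv.swap 2 3)
    have hne : ∀ k : Fin 3, k ≠ k + 1 := by decide
    have hn : ∀ (k : Fin 3) (p : Fin 4), p ≠ 3 → threeName k (Equiv.swap 2 3 p) =
      threeName (k + 1) ((1 : Equiv.Perm (Fin 4)) p) := by decide +kernel
    rwa [m.glue_three k (k + 1) _ 1 (hne k) (hn k)] at h
  have h3 : ∀ k u v, c' (m.three k) u v = C (threeName k u) (threeName k v) :=
    joinThree_threeName (d := d) (fun k => hc.antisymm _)
      (fun k => (hinner k 0 1 (by decide) (by decide)).symm)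
      (fun k => (hinner k 0 2 (by decide) (by decide)).symm)
      (fun k => (hinner k 1 2 (by decide) (by decide)).symm)
  obtain ⟨c, he', h2⟩ := exists_extension m.two_inj m.e.symm (fun j => c' j)
    (fun a u v => C (twoName a u) (twoName a v))
  replace h2 : ∀ a u v, c (m.two a) u v = C (twoName a u) (twoName a v) :=
    fun a u v => by rw [h2]
  have he : ∀ i, c' (m.e i) = c i := fun i => by
    have := he' (m.e i)
    rwa [Equiv.symm_apply_apply, eq_comm] at this
  have ha := m.agreeAt he h2 h3
  have hcases : ∀ i : Fin K.n, (∃ i' : {i // ∀ a, i ≠ m.two a}, i = (i' : Fin K.n)) ∨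
      ∃ a, i = m.two a := fun i => eq_or_eq_of_equiv (Equiv.refl _) i
  have hanti : ∀ i u v, c i v u = - c i u v := by
    intro j u v
    rcases hcases j with ⟨i, rfl⟩ | ⟨a, rfl⟩
    · rw [← he]; exact hc.antisymm _ _ _
    · rw [h2, h2]; exact joinThree_antisymm _ _ _
  have hodd : ∀ i u v, u ≠ v → Odd (c i u v) := by
    intro j u v huv
    rcases hcases j with ⟨i, rfl⟩ | ⟨a, rfl⟩
    · rw [← he]; exact hc.odd _ _ _ huv
    · rw [h2]
      exact odd_joinThree (fun k => hc.odd _) _ _ fun h => huv (twoName_injective a h)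
  have hglue_corr : ∀ F F', m.corr F F' → AgreeAt c F c (K.opp F) := fun F F' h =>
    agreeAt_of_corr (ha F F' h).symm (ha _ _ (m.glue F F' h)).symm (hc.glue F')
  have hcob_corr : ∀ F F', m.corr F F' → CobAt w c F := fun F F' h =>
    (hc.cob F').of_agree (ha F F' h).symm (m.sgn F F' h).symm (hd F F' h).symm
  have houter : ∀ a (σ : Equiv.Perm (Fin 4)), σ 3 ≠ 0 → ∃ F', m.corr (m.two a, σ) F' :=
    fun a σ h => by
      obtain ⟨k, σ', hn⟩ := two_outer_face a σ h
      exact ⟨(m.three k, σ'), Or.inr ⟨a, k, rfl, rfl, hn⟩⟩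
  refine ⟨c, ⟨hanti, hodd, ?_, ?_⟩, ha⟩
  · rintro ⟨j, σ⟩
    rcases hcases j with ⟨i, rfl⟩ | ⟨a, rfl⟩
    · exact hglue_corr _ _ (m.corr_e i σ)
    · by_cases h : σ 3 = 0
      · obtain ⟨a', hne, hn⟩ := two_inner_face a σ h
        rw [m.glue_two a a' σ σ hne hn]
        intro p q hp hq
        simp only [h2, hn p hp, hn q hq]
      · obtain ⟨F', hF⟩ := houter a σ h
        exact hglue_corr _ _ hF
  · rintro ⟨j, σ⟩
    rcases hcases j with ⟨i, rfl⟩ | ⟨a, rfl⟩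
    · exact hcob_corr _ _ (m.corr_e i σ)
    · have hside : ∀ σ : Equiv.Perm (Fin 4), σ 3 ≠ 0 → CobAt w c (m.two a, σ) := fun σ h => by
        obtain ⟨F', hF⟩ := houter a σ h
        exact hcob_corr _ _ hF
      by_cases h : σ 3 = 0
      · exact CobAt.of_other_faces (hanti _) σ fun τ hτ => hside τ (by rwa [h] at hτ)
      · exact hside σ h

end TwoThree

/-! ### The quadrilateral `0 → 2` move -/

/-- The cochain on a pillow tetrahedron that has the values `f` on the ordered face `0, 1, 2`, the
values `g` on the ordered face `0, 1, 3` and the value `x` on the edge `2, 3`. -/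
def pillow (f g : Fin 4 → Fin 4 → ℤ) (x : ℤ) : Fin 4 → Fin 4 → ℤ :=
  ![![0, f 0 1, f 0 2, g 0 2], ![-f 0 1, 0, f 1 2, g 1 2], ![-f 0 2, -f 1 2, 0, x],
    ![-g 0 2, -g 1 2, -x, 0]]

theorem pillow_antisymm (f g : Fin 4 → Fin 4 → ℤ) (x : ℤ) (u v : Fin 4) :
    pillow f g x v u = - pillow f g x u v := by
  fin_cases u <;> fin_cases v <;> simp [pillow]

theorem odd_pillow {f g : Fin 4 → Fin 4 → ℤ} {x : ℤ} (hf : ∀ u v, u ≠ v → Odd (f u v))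
    (hg : ∀ u v, u ≠ v → Odd (g u v)) (hx : Odd x) (u v : Fin 4) (h : u ≠ v) :
    Odd (pillow f g x u v) := by
  have a := hf 0 1 (by decide)
  have b := hf 0 2 (by decide)
  have c := hf 1 2 (by decide)
  have d := hg 0 2 (by decide)
  have e := hg 1 2 (by decide)
  fin_cases u <;> fin_cases v <;> first | exact absurd rfl h | skip
  all_goals simpa [pillow]

theorem pillow_eq_left {f g : Fin 4 → Fin 4 → ℤ} (hf : ∀ u v, f v u = - f u v) (x : ℤ)
    (p q : Fin 4) (hp : p ≠ 3) (hq : q ≠ 3) : f p q = pillow f g x p q := by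
  have hz : ∀ u, f u u = 0 := fun u => by have := hf u u; omega
  have a := hf 0 1
  have b := hf 0 2
  have c := hf 1 2
  fin_cases p <;> fin_cases q <;> first | exact absurd rfl hp | exact absurd rfl hq | skip
  all_goals simp [pillow, hz, a, b, c]

theorem pillow_eq_right {f g : Fin 4 → Fin 4 → ℤ} (hg : ∀ u v, g v u = - g u v)
    (h : f 0 1 = g 0 1) (x : ℤ) (p q : Fin 4) (hp : p ≠ 3) (hq : q ≠ 3) :
    g p q = pillow f g x (Equiv.swap 2 3 p) (Equiv.swap 2 3 q) := by
  have hz : ∀ u, g u u = 0 := fun u => by have := hg u u; omega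
  have a := hg 0 1
  have b := hg 0 2
  have c := hg 1 2
  have e : ∀ p : Fin 4, Equiv.swap 2 3 p = ![0, 1, 3, 2] p := by decide
  rw [e, e]
  fin_cases p <;> fin_cases q <;> first | exact absurd rfl hp | exact absurd rfl hq | skip
  all_goals simp [pillow, hz, a, b, c, h]

/-- Every flag met while rotating around an edge has that same edge as its first two vertices. This
makes the two triangles of the quadrilateral agree on their common edge. -/
theorem IsOddPotential.turn_opp_iterate {K : Gluing} {w : PreBranching K} {c : EdgeCochain K}
    (hc : IsOddPotential w c) (F : K.Flag) (n : ℕ) :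
    c (K.turn ((fun F => K.opp (K.turn F))^[n] F)).1
        ((K.turn ((fun F => K.opp (K.turn F))^[n] F)).2 0)
        ((K.turn ((fun F => K.opp (K.turn F))^[n] F)).2 1) = c F.1 (F.2 0) (F.2 1) := by
  have turn_eq : ∀ G : K.Flag, c (K.turn G).1 ((K.turn G).2 0) ((K.turn G).2 1) =
      c G.1 (G.2 0) (G.2 1) := fun G => by
    have e0 : (Equiv.swap 2 3 : Equiv.Perm (Fin 4)) 0 = 0 := by decide
    have e1 : (Equiv.swap 2 3 : Equiv.Perm (Fin 4)) 1 = 1 := by decide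
    simp only [Gluing.turn, Equiv.Perm.mul_apply, e0, e1]
  rw [turn_eq]
  induction n with
  | zero => rfl
  | succ n ih =>
    rw [Function.iterate_succ_apply']
    rw [← hc.glue _ 0 1 (by decide) (by decide), turn_eq, ih]

section ZeroTwo

variable {K K' : Gluing} (m : ZeroTwo K K')

theorem ZeroTwo.sgn_eq (F : K.Flag) : K.sgn F.1 * Equiv.Perm.sign F.2 =
    K'.sgn (m.e F.1) * Equiv.Perm.sign F.2 := by
  rw [m.sgn]

/-- The ordering of the vertices of the pillow tetrahedra along the sides of the quadrilateral. -/
abbrev sidePerm : Fin 2 → Equiv.Perm (Fin 4) := ![1, Equiv.swap 2 3]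

theorem ZeroTwo.opp_side (j : Fin 2) :
    K'.opp ((m.e (m.A j).1 : Fin K'.n), (m.A j).2) = (m.P 0, sidePerm j) := by
  fin_cases j
  · exact m.glue_side.1
  · exact m.glue_side.2

theorem ZeroTwo.opp_other_side (j : Fin 2) :
    K'.opp ((m.e (K.opp (m.A j)).1 : Fin K'.n), (K.opp (m.A j)).2) = (m.P 1, sidePerm j) := by
  fin_cases j
  · exact m.glue_other_side.1
  · exact m.glue_other_side.2

/-- A face of the triangulation is a side of the quadrilateral or is not involved in the move. -/
theorem ZeroTwo.face_cases (F : K.Flag) :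
    (∃ j, K.face F = K.face (m.A j)) ∨ (∃ j, K.face F = K.face (K.opp (m.A j))) ∨
      ∀ j, K.face F ≠ K.face (m.A j) ∧ K.face F ≠ K.face (K.opp (m.A j)) := by
  by_cases h1 : ∃ j, K.face F = K.face (m.A j)
  · exact Or.inl h1
  by_cases h2 : ∃ j, K.face F = K.face (K.opp (m.A j))
  · exact Or.inr (Or.inl h2)
  exact Or.inr (Or.inr fun j => ⟨fun h => h1 ⟨j, h⟩, fun h => h2 ⟨j, h⟩⟩)

theorem ZeroTwo.push_potential {w : PreBranching K} {w' : PreBranching K'} {c : EdgeCochain K}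
    (hc : IsOddPotential w c)
    (hd : ∀ F F', m.corr F F' → w.dir F.1 (F.2 3) = w'.dir F'.1 (F'.2 3)) :
    ∃ c', IsOddPotential w' c' ∧ ∀ F F', m.corr F F' → AgreeAt c F c' F' := by
  let f : Fin 2 → Fin 4 → Fin 4 → ℤ := fun j p q => c (m.A j).1 ((m.A j).2 p) ((m.A j).2 q)
  have hfanti : ∀ j u v, f j v u = - f j u v := fun j u v => hc.antisymm _ _ _
  have hfodd : ∀ j u v, u ≠ v → Odd (f j u v) := fun j u v h =>
    hc.odd _ _ _ fun h' => h ((m.A j).2.injective h')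
  have h01 : f 0 0 1 = f 1 0 1 := by
    obtain ⟨n, hn⟩ := m.rotate
    simp only [f]
    rw [hn, hc.turn_opp_iterate]
  -- Solves the coboundary equation on the inner face `1, 2, 3` of `P 0`, whose flag is `finRotate
  -- 4`.
  let x : ℤ := (K'.sgn (m.P 0) : ℤ) * Equiv.Perm.sign (finRotate 4) *
    w'.dir (m.P 0) 0 - f 0 1 2 + f 1 1 2
  have hx : Odd x := by
    have h := (odd_unit_mul_dir w' (K'.sgn (m.P 0)) (Equiv.Perm.sign (finRotate 4))
      (m.P 0) 0).sub_odd (hfodd 0 1 2 (by decide))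
    exact h.add_odd (hfodd 1 1 2 (by decide))
  let C := pillow (f 0) (f 1) x
  -- Both pillow tetrahedra carry the same cochain, so the inner gluings, which preserve labels, are
  -- respected.
  obtain ⟨c', he, hP⟩ := exists_extension m.P_inj m.e c (fun _ => C)
  have ha : ∀ F : K.Flag, AgreeAt c F c' ((m.e F.1 : Fin K'.n), F.2) := by
    intro F p q _ _
    simp only [he]
  have hside : ∀ j s, AgreeAt c (m.A j) c' (m.P s, sidePerm j) := by
    intro j s p q hp hq
    simp only [hP]
    fin_cases j
    · exact pillow_eq_left (hfanti 0) x p q hp hq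
    · exact pillow_eq_right (hfanti 1) h01 x p q hp hq
  have hanti : ∀ i u v, c' i v u = - c' i u v := by
    intro j u v
    rcases eq_or_eq_of_equiv m.e j with ⟨i, rfl⟩ | ⟨s, rfl⟩
    · rw [he]; exact hc.antisymm _ _ _
    · rw [hP]; exact pillow_antisymm _ _ _ _ _
  have hodd : ∀ i u v, u ≠ v → Odd (c' i u v) := by
    intro j u v huv
    rcases eq_or_eq_of_equiv m.e j with ⟨i, rfl⟩ | ⟨s, rfl⟩
    · rw [he]; exact hc.odd _ _ _ huv
    · rw [hP]; exact odd_pillow (hfodd 0) (hfodd 1) hx u v huv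
  have hglue_side : ∀ j, AgreeAt c' ((m.e (m.A j).1 : Fin K'.n), (m.A j).2) c'
      (K'.opp ((m.e (m.A j).1 : Fin K'.n), (m.A j).2)) := by
    intro j
    rw [m.opp_side]
    exact (ha _).symm.trans (hside j 0)
  have hglue_other : ∀ j, AgreeAt c' ((m.e (K.opp (m.A j)).1 : Fin K'.n), (K.opp (m.A j)).2) c'
      (K'.opp ((m.e (K.opp (m.A j)).1 : Fin K'.n), (K.opp (m.A j)).2)) := by
    intro j
    rw [m.opp_other_side]
    exact ((ha _).symm.trans (hc.glue _).symm).trans (hside j 1)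
  have hglue_P : ∀ s j, AgreeAt c' (m.P s, sidePerm j) c' (K'.opp (m.P s, sidePerm j)) := by
    intro s j
    fin_cases s
    · have h := agreeAt_opp_opp (hglue_side j)
      rwa [m.opp_side] at h
    · have h := agreeAt_opp_opp (hglue_other j)
      rwa [m.opp_other_side] at h
  have hinner : ∀ s (σ : Equiv.Perm (Fin 4)), σ 3 = 0 ∨ σ 3 = 1 →
      AgreeAt c' (m.P s, σ) c' (K'.opp (m.P s, σ)) := by
    intro s σ hσ
    fin_cases s
    · change AgreeAt c' (m.P 0, σ) c' (K'.opp (m.P 0, σ))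
      rw [m.glue_inner σ hσ]
      intro p q _ _
      simp only [hP]
    · change AgreeAt c' (m.P 1, σ) c' (K'.opp (m.P 1, σ))
      rw [← m.glue_inner σ hσ, K'.opp_opp, m.glue_inner σ hσ]
      intro p q _ _
      simp only [hP]
  have hglue : ∀ F', AgreeAt c' F' c' (K'.opp F') := by
    rintro ⟨j, σ⟩
    rcases eq_or_eq_of_equiv m.e j with ⟨i, rfl⟩ | ⟨s, rfl⟩
    · rcases m.face_cases (i, σ) with ⟨j, hj⟩ | ⟨j, hj⟩ | hF
      · obtain ⟨h1, h2⟩ := Prod.ext_iff.1 hj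
        obtain rfl : i = (m.A j).1 := h1
        exact (hglue_side j).opp_of_face_eq σ h2
      · obtain ⟨h1, h2⟩ := Prod.ext_iff.1 hj
        obtain rfl : i = (K.opp (m.A j)).1 := h1
        exact (hglue_other j).opp_of_face_eq σ h2
      · have h := m.glue (i, σ) hF
        refine agreeAt_of_corr (ha (i, σ)) ?_ (hc.glue _)
        rw [h]
        exact ha _
    · by_cases h : σ 3 = 0 ∨ σ 3 = 1
      · exact hinner s σ h
      · rcases (show σ 3 = 3 ∨ σ 3 = 2 by omega) with h | h
        · exact (hglue_P s 0).opp_of_face_eq σ h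
        · exact (hglue_P s 1).opp_of_face_eq σ h
  have hcob_e : ∀ F : K.Flag, CobAt w' c' ((m.e F.1 : Fin K'.n), F.2) := fun F =>
    (hc.cob F).of_agree (ha F) (m.sgn_eq F) (hd F _ rfl)
  have hcob_side : ∀ s j, CobAt w' c' (m.P s, sidePerm j) := by
    intro s j
    fin_cases s
    · have h := (hcob_e (m.A j)).opp (hglue _)
      rwa [m.opp_side] at h
    · have h := (hcob_e (K.opp (m.A j))).opp (hglue _)
      rwa [m.opp_other_side] at h
  have hzero : CobAt w' c' (m.P 0, finRotate 4) := by
    have e0 : finRotate 4 0 = 1 := rfl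
    have e1 : finRotate 4 1 = 2 := rfl
    have e2 : finRotate 4 2 = 3 := rfl
    have e3 : finRotate 4 3 = 0 := by decide
    simp only [CobAt, circ, hP, e0, e1, e2, e3]
    change f 0 1 2 + x + - f 1 1 2 = _
    simp only [x]
    ring
  have hne_one : ∀ s, CobAt w' c' (m.P s, finRotate 4) → ∀ σ : Equiv.Perm (Fin 4), σ 3 ≠ 1 →
      CobAt w' c' (m.P s, σ) := by
    intro s hs σ hσ
    rcases (show σ 3 = 3 ∨ σ 3 = 2 ∨ σ 3 = 0 by omega) with h | h | h
    · exact (hcob_side s 0).of_face_eq (hanti _) σ h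
    · exact (hcob_side s 1).of_face_eq (hanti _) σ h
    · exact hs.of_face_eq (hanti _) σ h
  have hfour : ∀ s, CobAt w' c' (m.P s, finRotate 4) → ∀ σ, CobAt w' c' (m.P s, σ) := by
    intro s hs σ
    by_cases h : σ 3 = 1
    · exact CobAt.of_other_faces (hanti _) σ fun τ hτ => hne_one s hs τ (by rwa [h] at hτ)
    · exact hne_one s hs σ h
  have hone : CobAt w' c' (m.P 1, finRotate 4) := by
    have h := hzero.opp (hglue _)
    rwa [m.glue_inner _ (Or.inl (by decide))] at h
  refine ⟨c', ⟨hanti, hodd, hglue, ?_⟩, ?_⟩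
  · rintro ⟨j, σ⟩
    rcases eq_or_eq_of_equiv m.e j with ⟨i, rfl⟩ | ⟨s, rfl⟩
    · exact hcob_e (i, σ)
    · fin_cases s
      · exact hfour 0 hzero σ
      · exact hfour 1 hone σ
  · rintro F _ rfl
    exact ha F

/-- The delicate point is the diagonal `01`: the two pillow tetrahedra share their other five edges
through the inner faces, but not a priori this one. The values on it must agree before the pillow
can be flattened. -/
theorem ZeroTwo.pull_potential {w : PreBranching K} {w' : PreBranching K'}
    {c' : EdgeCochain K'} (hc : IsOddPotential w' c')
    (hd : ∀ F F', m.corr F F' → w.dir F.1 (F.2 3) = w'.dir F'.1 (F'.2 3)) :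
    ∃ c, IsOddPotential w c ∧ ∀ F F', m.corr F F' → AgreeAt c F c' F' := by
  let c : EdgeCochain K := fun i => c' (m.e i)
  have ha : ∀ F : K.Flag, AgreeAt c F c' ((m.e F.1 : Fin K'.n), F.2) := fun F p q _ _ => rfl
  have hinner : ∀ σ : Equiv.Perm (Fin 4), σ 3 = 0 ∨ σ 3 = 1 →
      ∀ u v, u ≠ σ 3 → v ≠ σ 3 → c' (m.P 0) u v = c' (m.P 1) u v := by
    intro σ hσ u v hu hv
    have h := hc.glue (m.P 0, σ)
    rw [m.glue_inner σ hσ] at h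
    have ne : ∀ u, u ≠ σ 3 → σ.symm u ≠ 3 := fun u hu h => hu (by rw [← h]; simp)
    simpa using h _ _ (ne u hu) (ne v hv)
  have h0 := hinner (Equiv.swap 3 0) (by simp)
  have h1 := hinner (Equiv.swap 3 1) (by simp)
  simp only [Equiv.swap_apply_left] at h0 h1
  have hsgn : K'.sgn (m.P 1) = - K'.sgn (m.P 0) := by
    have h := K'.sgn_opp (m.P 0, Equiv.swap 3 0)
    rw [m.glue_inner _ (Or.inl (by simp))] at h
    rw [← neg_eq_iff_eq_neg]
    simpa [Equiv.Perm.sign_swap] using h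
  -- The outer faces `0, 1, 2` of the pillow are attached to the two sides of one face of the
  -- initial triangulation, and both copies carry its transverse orientation.
  have hdir : w'.dir (m.P 1) 3 = - w'.dir (m.P 0) 3 := by
    have a := w'.dir_opp ((m.e (m.A 0).1 : Fin K'.n), (m.A 0).2)
    have b := w'.dir_opp ((m.e (K.opp (m.A 0)).1 : Fin K'.n), (K.opp (m.A 0)).2)
    rw [m.opp_side] at a
    rw [m.opp_other_side] at b
    have a' := hd (m.A 0) _ rfl
    have b' := hd (K.opp (m.A 0)) _ rfl
    have h := w.dir_opp (m.A 0)
    simp only [sidePerm, Matrix.cons_val_zero, Equiv.Perm.one_apply] at a b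
    simp only at a' b'
    linarith
  -- From `P 0` to `P 1` both the sign and the direction at the face `0, 1, 2` change, so the
  -- circulations are equal; the edges `12` and `20` agree, hence so does `01`.
  have h01 : c' (m.P 0) 0 1 = c' (m.P 1) 0 1 := by
    have a := hc.cob (m.P 0, 1)
    have b := hc.cob (m.P 1, 1)
    simp only [CobAt, circ, Equiv.Perm.one_apply, hsgn, hdir] at a b
    rw [← h0 1 2 (by decide) (by decide), ← h1 2 0 (by decide) (by decide)] at b
    push_cast at a b
    linarith
  have hP : ∀ u v, c' (m.P 0) u v = c' (m.P 1) u v := by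
    intro u v
    by_cases hu : u ≠ 0 ∧ v ≠ 0
    · exact h0 u v hu.1 hu.2
    by_cases hv : u ≠ 1 ∧ v ≠ 1
    · exact h1 u v hv.1 hv.2
    rcases (show (u = 0 ∧ v = 1) ∨ (u = 1 ∧ v = 0) by omega) with ⟨rfl, rfl⟩ | ⟨rfl, rfl⟩
    · exact h01
    · rw [hc.antisymm _ 0 1, h01, hc.antisymm _ 0 1]
  have hglue_side : ∀ j, AgreeAt c (m.A j) c (K.opp (m.A j)) := by
    intro j
    have h := hc.glue ((m.e (m.A j).1 : Fin K'.n), (m.A j).2)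
    have h' := hc.glue ((m.e (K.opp (m.A j)).1 : Fin K'.n), (K.opp (m.A j)).2)
    rw [m.opp_side] at h
    rw [m.opp_other_side] at h'
    have hPj : AgreeAt c' (m.P 0, sidePerm j) c' (m.P 1, sidePerm j) := fun p q _ _ => hP _ _
    exact ((ha _).trans (h.trans (hPj.trans h'.symm))).trans (ha _).symm
  refine ⟨c, ⟨fun i => hc.antisymm _, fun i => hc.odd _, ?_, ?_⟩, ?_⟩
  · rintro ⟨i, σ⟩
    rcases m.face_cases (i, σ) with ⟨j, hj⟩ | ⟨j, hj⟩ | hF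
    · obtain ⟨h1, h2⟩ := Prod.ext_iff.1 hj
      obtain rfl : i = (m.A j).1 := h1
      exact (hglue_side j).opp_of_face_eq σ h2
    · obtain ⟨h1, h2⟩ := Prod.ext_iff.1 hj
      obtain rfl : i = (K.opp (m.A j)).1 := h1
      exact (agreeAt_opp_opp (hglue_side j)).opp_of_face_eq σ h2
    · refine agreeAt_of_corr (ha (i, σ)).symm ?_ (hc.glue _)
      rw [m.glue (i, σ) hF]
      exact (ha _).symm
  · intro F
    exact (hc.cob _).of_agree (ha F).symm (m.sgn_eq F).symm (hd F _ rfl).symm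
  · rintro F _ rfl
    exact ha F

end ZeroTwo

/-! ## Lifting `pb`-transits to `b`-transits -/

section Lift

variable {M : Type*} [TopologicalSpace M] [ChartedSpace (EuclideanHalfSpace 3) M]
  {o : Orientation3 (Int M)}

theorem NakedStep.push_potential {T T' : IdealTriangulation o} {R : T.K.Flag → T'.K.Flag → Prop}
    (h : NakedStep T T' R) {w : PreBranching T.K} {w' : PreBranching T'.K}
    (hd : ∀ F F', R F F' → w.dir F.1 (F.2 3) = w'.dir F'.1 (F'.2 3)) {c : EdgeCochain T.K}
    (hc : IsOddPotential w c) :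
    ∃ c', IsOddPotential w' c' ∧ ∀ F F', R F F' → AgreeAt c F c' F' := by
  rcases h with ⟨m, rfl, _⟩ | ⟨m, rfl, _⟩ | ⟨m, rfl, _⟩
  · exact m.push_potential hc hd
  · exact m.push_potential hc hd
  · exact m.push_potential hc hd

theorem NakedStep.pull_potential {T T' : IdealTriangulation o} {R : T.K.Flag → T'.K.Flag → Prop}
    (h : NakedStep T T' R) {w : PreBranching T.K} {w' : PreBranching T'.K}
    (hd : ∀ F F', R F F' → w.dir F.1 (F.2 3) = w'.dir F'.1 (F'.2 3)) {c' : EdgeCochain T'.K}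
    (hc : IsOddPotential w' c') :
    ∃ c, IsOddPotential w c ∧ ∀ F F', R F F' → AgreeAt c F c' F' := by
  rcases h with ⟨m, rfl, _⟩ | ⟨m, rfl, _⟩ | ⟨m, rfl, _⟩
  · exact m.pull_potential hc hd
  · exact m.pull_potential hc hd
  · exact m.pull_potential hc hd

/-- Potentials that agree on persistent edges have the same signs there, which is what a `b`-transit
requires. -/
theorem BStep.of_isSignOf {T T' : IdealTriangulation o} {R : T.K.Flag → T'.K.Flag → Prop}
    (h : NakedStep T T' R) {c : EdgeCochain T.K} {c' : EdgeCochain T'.K}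
    (ha : ∀ F F', R F F' → AgreeAt c F c' F') {b : Branching T.K} {b' : Branching T'.K}
    (hb : IsSignOf b c) (hb' : IsSignOf b' c') : BStep (o := o) ⟨T, b⟩ ⟨T', b'⟩ := by
  refine ⟨R, h, fun F F' hF p q hp hq => ?_⟩
  change b.ord F.1 (F.2 p) < b.ord F.1 (F.2 q) ↔ b'.ord F'.1 (F'.2 p) < b'.ord F'.1 (F'.2 q)
  rw [hb, hb', ha F F' hF p q hp hq]

/-- The pre-branching has an odd potential whose sign is a branching of class `β`. -/
def HasPotentialOver (β : BId o) (x : PreBranchedTri o) : Prop :=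
  ∃ c, IsOddPotential x.2 c ∧ ∃ b, IsSignOf b c ∧ BId.mk x.1 b = β

/-- The transported potential again has a branching as its sign, and the two branchings differ by a
`b`-transit, so the class `β` is kept. Both directions are needed because the equivalence also
contains negative transits. -/
theorem PBStep.hasPotentialOver_iff (β : BId o) {x y : PreBranchedTri o} (h : PBStep x y) :
    HasPotentialOver β x ↔ HasPotentialOver β y := by
  obtain ⟨R, hR, hd⟩ := h
  constructor
  · rintro ⟨c, hc, b, hb, rfl⟩
    obtain ⟨c', hc', ha⟩ := hR.push_potential hd hc
    obtain ⟨b', hb'⟩ := hc'.exists_branching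
    exact ⟨c', hc', b', hb', (Quot.sound (BStep.of_isSignOf hR ha hb hb')).symm⟩
  · rintro ⟨c', hc', b', hb', rfl⟩
    obtain ⟨c, hc, ha⟩ := hR.pull_potential hd hc'
    obtain ⟨b, hb⟩ := hc.exists_branching
    exact ⟨c, hc, b, hb, Quot.sound (BStep.of_isSignOf hR ha hb hb')⟩

/-- Invariance under single steps makes the property a function on the quotient, so no chain of
moves has to be followed. -/
theorem hasPotentialOver_iff_of_mk_eq (β : BId o) {T T' : IdealTriangulation o}
    {w : PreBranching T.K} {w' : PreBranching T'.K} (h : PBId.mk T w = PBId.mk T' w') :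
    HasPotentialOver β ⟨T, w⟩ ↔ HasPotentialOver β ⟨T', w'⟩ :=
  iff_of_eq (congrArg (Quot.lift (HasPotentialOver β)
    fun _ _ hs => propext (PBStep.hasPotentialOver_iff β hs)) h)

/-- If the class of a pre-branching comes from a branching class, then that branching class is
represented on the same triangulation. -/
theorem exists_branching_of_forgetting_eq {β : BId o} {T : IdealTriangulation o}
    {w : PreBranching T.K} (h : forgetting o β = PBId.mk T w) :
    ∃ b : Branching T.K, BId.mk T b = β := by
  induction β using Quot.ind with
  | mk x =>
    obtain ⟨T', b'⟩ := x
    have h0 : HasPotentialOver (BId.mk T' b') ⟨T', b'.toPre⟩ :=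
      ⟨b'.cochain, b'.isOddPotential_cochain, b', b'.isSignOf_cochain, rfl⟩
    obtain ⟨_, _, b, _, hb⟩ := (hasPotentialOver_iff_of_mk_eq (BId.mk T' b') h).1 h0
    exact ⟨b, hb⟩

end Lift

end IdealTri

theorem mainTheorem8 {M : Type*} [TopologicalSpace M] [ChartedSpace (EuclideanHalfSpace 3) M]
    [IsManifold (𝓡∂ 3) ∞ M] [T2Space M] [CompactSpace M] [ConnectedSpace M]
    (hM : ((𝓡∂ 3).boundary M).Nonempty) (o : IdealTri.Orientation3 (IdealTri.Int M))
    (T : IdealTri.IdealTriangulation o) (w : IdealTri.PreBranching T.K) :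
    IdealTri.PBId.mk T w ∈ Set.range (IdealTri.forgetting o) ↔
      ∃ b : IdealTri.Branching T.K, IdealTri.PBId.mk T w = IdealTri.PBId.mk T b.toPre := by
  constructor
  · rintro ⟨β, h⟩
    -- The pre-branching `b.toPre` need not equal `w`; both represent the image of the class of `b`.
    obtain ⟨b, rfl⟩ := IdealTri.exists_branching_of_forgetting_eq h
    exact ⟨b, h.symm⟩
  · rintro ⟨b, h⟩
    exact ⟨IdealTri.BId.mk T b, h.symm⟩
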